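/- Let $I\subseteq\mathbb{R}$ be an open interval and $\kappa:I\to\mathbb{R}$ continuous. For $t_0\in I$ let $c(\cdot,t_0)$, $s(\cdot,t_0)$ be the solutions on $I$ of $\ddot u+\kappa u=0$ with $c(t_0,t_0)=\dot s(t_0,t_0)=1$ and $\dot c(t_0,t_0)=s(t_0,t_0)=0$ (dots denote derivatives in the first argument). On $L^2(\mathbb{R},\mathrm{d}q)$ let $(Q\psi)(q)=q\psi(q)$, $(P\psi)(q)=-i\psi'(q)$, $H(t)=\tfrac12(P^2+\kappa(t)Q^2)$ on $\mathscr{S}(\mathbb{R})$, and let $U(t,t_0)$, $t,t_0\in I$, be the unitary evolution generated by $H(t)$: $U(t_0,t_0)=\mathbf 1$ and $\partial_tU(t,t_0)=-iH(t)U(t,t_0)$ (in the sense of matrix elements: $\partial_t\langle\varphi|U(t,t_0)\psi\rangle=-i\langle H(t)\varphi|U(t,t_0)\psi\rangle$ for all $\varphi,\psi\in\mathscr S(\mathbb R)$, the inner product being linear in the second argument). For $\omega>0$ and $n\in\mathbb{N}_0$ put $$\phi_n^\omega(q)=\frac{\omega^{1/4}}{\sqrt{2^nn!\sqrt\pi}}\,e^{-\omega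 q^2/2}H_n(\sqrt\omega\,q),$$ with $H_n$ the (physicists') Hermite polynomials, and $$A_\omega(t,t_0)=\tfrac12\big(c(t,t_0)+\dot s(t,t_0)+i(\omega^{-1}\dot c(t,t_0)-\omega s(t,t_0))\big),$$ $$B_\omega(t,t_0)=\tfrac12\big(c(t,t_0)-\dot s(t,t_0)+i(\omega^{-1}\dot c(t,t_0)+\omega s(t,t_0))\big).$$ When $s(t,t_0)\neq0$ let $$\Lambda=\Lambda(t_0,t;\omega,\omega)=\begin{pmatrix}\omega-i\,c(t,t_0)/s(t,t_0)& i/s(t,t_0)\\ i/s(t,t_0)&\omega-i\,c(t_0,t)/s(t,t_0)\end{pmatrix}$$ and $s^{-1/2}(t,t_0)=e^{-i\pi m(t,t_0)/2}|s(t,t_0)|^{-1/2}$, where $m(t_0,t_0)=0$ and $m(t_2,t_0)-m(t_1,t_0)$, $t_1<t_2$, is the number of zeros of $s(\cdot,t_0)$ in $(t_1,t_2]$. **Theorem.** For all $t,t_0\in I$ and $\omega>0$: 1. $U(t,t_0)\phi_0^\omega=\sum_{n\ge0}\langle\phi_{2n}^\omega|U(t,t_0)\phi_0^\omega\rangle\,\phi_{2n}^\omega$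 in $L^2(\mathbb{R})$, and $\langle\phi_{2n+1}^\omega|U(t,t_0)\phi_0^\omega\rangle=0$ for all $n\ge 0$. 2. $A_\omega(t_0,t)\neq0$ and, for all $n\ge0$, $$\langle\phi_{2n}^\omega|U(t,t_0)\phi_0^\omega\rangle=\frac{\sqrt{(2n)!}}{2^nn!}\Big(-\frac{B_\omega(t_0,t)}{A_\omega(t_0,t)}\Big)^n\langle\phi_0^\omega|U(t,t_0)\phi_0^\omega\rangle .$$ 3. If $s(t,t_0)\ne0$, then $\det\Lambda\neq0$; for all $n\ge 0$ the amplitude is also $$\langle\phi_{2n}^\omega|U(t,t_0)\phi_0^\omega\rangle=\frac{\sqrt{(2n)!}}{2^nn!}\big(2\omega(\Lambda^{-1})_{22}-1\big)^n\langle\phi_0^\omega|U(t,t_0)\phi_0^\omega\rangle ;$$ the vacuum-to-vacuum amplitude is, with the principal square root, $$\langle\phi_0^\omega|U(t,t_0)\phi_0^\omega\rangle=\sqrt{\frac{2\omega}{\det\Lambda}}\;e^{-i\pi/4}\,s^{-1/2}(t,t_0);$$ and $$(\Lambda^{-1})_{22}=\frac{\omega s^2(t,t_0)-i\,s(t,t_0)c(t,t_0)}{1+\omega^2s^2(t,t_0)-c(t,t_0)c(t_0,t)-i\omega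 s(t,t_0)\big(c(t,t_0)+c(t_0,t)\big)},$$ with non-zero denominator. 4. If $s(t,t_0)=0$, then $\langle\phi_0^\omega|U(t,t_0)\phi_0^\omega\rangle$ is the limit, as $\tau\to t$ with $\tau\ne t$, of the right-hand side of the vacuum amplitude formula in 3 at $(\tau,t_0)$. -/

import Mathlib

open MeasureTheory Set Filter Topology
open scoped SchwartzMap InnerProductSpace

namespace TDHO

/-! ### The classical equation -/

/-- `u` solves `u'' + κ u = 0` on the (open) set `I`. -/
def IsSolution (κ : ℝ → ℝ) (I : Set ℝ) (u : ℝ → ℝ) : Prop :=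
  ∀ t ∈ I, DifferentiableAt ℝ u t ∧ HasDerivAt (deriv u) (-(κ t * u t)) t

/-- `c(t, t₀)` and `s(t, t₀)`: for every `t₀ ∈ I`, the functions `c(·, t₀)` and `s(·, t₀)` are the
solutions of `u'' + κ u = 0` on `I` with Cauchy data `(1, 0)` and `(0, 1)` at `t₀`. -/
structure IsFundamentalPair (κ : ℝ → ℝ) (I : Set ℝ) (c s : ℝ → ℝ → ℝ) : Prop where
  c_solution : ∀ t₀ ∈ I, IsSolution κ I (fun t => c t t₀)
  c_initial : ∀ t₀ ∈ I, c t₀ t₀ = 1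
  c_deriv_initial : ∀ t₀ ∈ I, deriv (fun t => c t t₀) t₀ = 0
  s_solution : ∀ t₀ ∈ I, IsSolution κ I (fun t => s t t₀)
  s_initial : ∀ t₀ ∈ I, s t₀ t₀ = 0
  s_deriv_initial : ∀ t₀ ∈ I, deriv (fun t => s t t₀) t₀ = 1

/-- `u̇(t, t₀)`: the derivative in the first time argument. -/
noncomputable def dot (u : ℝ → ℝ → ℝ) (t t₀ : ℝ) : ℝ := deriv (fun τ => u τ t₀) t

/-- The index `m(u; t, t₀)`: it is `0` at `t = t₀`, and
`m(u; t₂, t₀) - m(u; t₁, t₀)` is the number of zeros of `u` in `(t₁, t₂]` for `t₁ < t₂`. -/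
noncomputable def zeroIndex (u : ℝ → ℝ) (t t₀ : ℝ) : ℤ :=
  ({τ ∈ Ioc t₀ t | u τ = 0}.ncard : ℤ) - ({τ ∈ Ioc t t₀ | u τ = 0}.ncard : ℤ)

/-- The power `u^ε(t, t₀) = exp(i ε π m(u; t, t₀)) |u(t)|^ε`. -/
noncomputable def indexPow (u : ℝ → ℝ) (ε t t₀ : ℝ) : ℂ :=
  Complex.exp (Complex.I * ε * Real.pi * (zeroIndex u t t₀ : ℂ)) * ((|u t| ^ ε : ℝ) : ℂ)

/-! ### The Bogoliubov coefficients and the matrix `Λ` -/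

/-- `A_ω(t, t₀)`. -/
noncomputable def bogoliubovA (c s : ℝ → ℝ → ℝ) (ω t t₀ : ℝ) : ℂ :=
  (1 / 2) * ((c t t₀ + dot s t t₀ : ℝ) + Complex.I * (ω⁻¹ * dot c t t₀ - ω * s t t₀ : ℝ))

/-- `B_ω(t, t₀)`. -/
noncomputable def bogoliubovB (c s : ℝ → ℝ → ℝ) (ω t t₀ : ℝ) : ℂ :=
  (1 / 2) * ((c t t₀ - dot s t t₀ : ℝ) + Complex.I * (ω⁻¹ * dot c t t₀ + ω * s t t₀ : ℝ))

/-- `Λ(t₁, t₂; ω₁, ω₂)`. -/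
noncomputable def Lam (c s : ℝ → ℝ → ℝ) (t₁ t₂ ω₁ ω₂ : ℝ) : Matrix (Fin 2) (Fin 2) ℂ :=
  !![ω₁ - Complex.I * (c t₂ t₁ / s t₂ t₁ : ℝ), Complex.I / (s t₂ t₁ : ℂ);
     Complex.I / (s t₂ t₁ : ℂ), ω₂ - Complex.I * (c t₁ t₂ / s t₂ t₁ : ℝ)]

/-! ### The quantum theory in the Schrödinger representation -/

/-- The Hilbert space `L²(ℝ, dq)`. -/
abbrev L2 : Type := Lp ℂ 2 (volume : Measure ℝ)

/-- The position operator `(Qψ)(q) = q ψ(q)` on Schwartz functions. -/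
noncomputable def opQ : 𝓢(ℝ, ℂ) →ₗ[ℂ] 𝓢(ℝ, ℂ) :=
  (SchwartzMap.smulLeftCLM ℂ (fun q : ℝ => (q : ℂ))).toLinearMap

/-- The momentum operator `(Pψ)(q) = -i ψ'(q)` on Schwartz functions. -/
noncomputable def opP : 𝓢(ℝ, ℂ) →ₗ[ℂ] 𝓢(ℝ, ℂ) :=
  (-Complex.I) • (SchwartzMap.derivCLM ℂ ℂ).toLinearMap

/-- The Hamiltonian `H(t) = (P² + κ(t) Q²) / 2` on Schwartz functions. -/
noncomputable def hamiltonian (κ : ℝ → ℝ) (t : ℝ) : 𝓢(ℝ, ℂ) →ₗ[ℂ] 𝓢(ℝ, ℂ) :=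
  (1 / 2 : ℂ) • (opP ∘ₗ opP + (κ t : ℂ) • (opQ ∘ₗ opQ))

theorem opQ_apply (ψ : 𝓢(ℝ, ℂ)) (q : ℝ) : opQ ψ q = q * ψ q := by
  have h : Function.HasTemperateGrowth (fun q : ℝ => (q : ℂ)) :=
    Complex.ofRealCLM.hasTemperateGrowth
  simp [opQ, SchwartzMap.smulLeftCLM_apply_apply h]

theorem opP_apply (ψ : 𝓢(ℝ, ℂ)) (q : ℝ) : opP ψ q = -Complex.I * deriv ψ q := by
  simp [opP]

/-- The unitary evolution `U(t, t₀)`, `t, t₀ ∈ I`, generated by the Hamiltonians `H(t)`: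
`U(t₀, t₀) = 1` and `∂ₜ U(t, t₀) = -i H(t) U(t, t₀)`. The equation is read in the sense of matrix
elements between Schwartz functions, with the symmetric operator `H(t)` moved to the left:
`∂ₜ ⟨φ | U(t, t₀) ψ⟩ = -i ⟨H(t) φ | U(t, t₀) ψ⟩`. -/
structure IsEvolution (κ : ℝ → ℝ) (I : Set ℝ) (U : ℝ → ℝ → (L2 ≃ₗᵢ[ℂ] L2)) : Prop where
  initial : ∀ t₀ ∈ I, ∀ ψ : L2, U t₀ t₀ ψ = ψ
  schrodinger : ∀ t₀ ∈ I, ∀ t ∈ I, ∀ φ ψ : 𝓢(ℝ, ℂ),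
    HasDerivAt (fun τ => ⟪φ.toLp 2, U τ t₀ (ψ.toLp 2)⟫_ℂ)
      (-Complex.I * ⟪(hamiltonian κ t φ).toLp 2, U t t₀ (ψ.toLp 2)⟫_ℂ) t

/-- The physicists' Hermite polynomials: `H₀ = 1`, `Hₙ₊₁ = 2 X Hₙ - Hₙ'`. -/
noncomputable def hermiteH : ℕ → Polynomial ℝ
  | 0 => 1
  | n + 1 => 2 * Polynomial.X * hermiteH n - Polynomial.derivative (hermiteH n)

/-- `φₙ^ω(q) = ω^{1/4} (2ⁿ n! √π)^{-1/2} exp(-ω q² / 2) Hₙ(√ω q)`. -/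
noncomputable def phiFun (ω : ℝ) (n : ℕ) (q : ℝ) : ℝ :=
  ω ^ (1 / 4 : ℝ) / Real.sqrt (2 ^ n * (n.factorial : ℝ) * Real.sqrt Real.pi) *
    Real.exp (-ω * q ^ 2 / 2) * (hermiteH n).eval (Real.sqrt ω * q)

theorem integrable_polynomial_mul_gaussian {b : ℝ} (hb : 0 < b) (p : Polynomial ℝ) :
    Integrable (fun q : ℝ => p.eval q * Real.exp (-b * q ^ 2)) := by
  induction p using Polynomial.induction_on' with
  | add p r hp hr =>
    refine (hp.add hr).congr (Eventually.of_forall fun q => ?_)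
    simp [add_mul]
  | monomial n a =>
    have h := (integrable_rpow_mul_exp_neg_mul_sq hb
      (s := (n : ℝ)) (by linarith [Nat.cast_nonneg (α := ℝ) n])).const_mul a
    simpa [Real.rpow_natCast, mul_assoc] using h

theorem memLp_phiFun {ω : ℝ} (hω : 0 < ω) (n : ℕ) :
    MemLp (fun q => (phiFun ω n q : ℂ)) 2 (volume : Measure ℝ) := by
  have hc : Continuous (phiFun ω n) := by
    unfold phiFun
    fun_prop
  refine (memLp_two_iff_integrable_sq_norm
    (Complex.continuous_ofReal.comp hc).aestronglyMeasurable).2 ?_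
  have h := (integrable_polynomial_mul_gaussian hω
    (((hermiteH n).comp (Polynomial.C (Real.sqrt ω) * Polynomial.X)) ^ 2)).const_mul
      ((ω ^ (1 / 4 : ℝ) / Real.sqrt (2 ^ n * (n.factorial : ℝ) * Real.sqrt Real.pi)) ^ 2)
  refine h.congr (Eventually.of_forall fun q => ?_)
  have he : Real.exp (-ω * q ^ 2) = Real.exp (-ω * q ^ 2 / 2) ^ 2 := by
    rw [← Real.exp_nat_mul]
    congr 1
    push_cast
    ring
  simp only [Function.comp_apply, Complex.norm_real, Real.norm_eq_abs, sq_abs, phiFun, Polynomial.eval_pow,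
    Polynomial.eval_comp, Polynomial.eval_mul, Polynomial.eval_C, Polynomial.eval_X, he]
  ring

/-- The state `φₙ^ω ∈ L²(ℝ)`. -/
noncomputable def phi {ω : ℝ} (hω : 0 < ω) (n : ℕ) : L2 := (memLp_phiFun hω n).toLp _

/-- The explicit vacuum expectation value
`√(2ω / det Λ(t₀, t; ω, ω)) exp(-iπ/4) s^{-1/2}(t, t₀)`, with the principal square root. -/
noncomputable def vacuumAmplitude (c s : ℝ → ℝ → ℝ) (ω t t₀ : ℝ) : ℂ :=
  (2 * (ω : ℂ) / (Lam c s t₀ t ω ω).det) ^ (1 / 2 : ℂ) *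
    Complex.exp (-(Complex.I * Real.pi / 4)) * indexPow (fun τ => s τ t₀) (-1 / 2) t t₀

end TDHO

namespace TDHO

/-! ### Wronskians and the reversal of the two times -/

/-! The vacuum stays Gaussian. With `u = c + iωs`, `Z = -iu'/u` and `g = ∫ u'/u`, the function
`(ω/π)^{1/4} exp(-g/2) exp(-Z q²/2)` solves the Schrödinger equation strongly in `L²`. The Wronskian
identity `cṡ - ċs = 1` keeps `u` away from zero and gives `Re Z = ω/|u|² > 0`. As `U` satisfies its
equation only weakly, the two are compared through their inner product: it is constant, equal to 1,
and both vectors are unit vectors, so they coincide (`IsEvolution.apply_eq_of_strong_solution`).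

The amplitudes are then integrals of Hermite polynomials against `exp(-a q²)`, `a = (ω + Z)/2`.
Integration by parts gives a two-step recursion with ratio proportional to `ω/a - 1 = (ω - Z)/(ω +
Z) = -B/A`; hence the odd integrals vanish and the even ones are powers of `-B/A`. Since `|A|² -
|B|² = 1`, the squared amplitudes form a central binomial series of sum 1, so the even states
already exhaust the norm and completeness of the Hermite functions is not needed.

The vacuum amplitude is `√(2ω) exp(-g/2) (ω + Z)^{-1/2}`, where `exp(-g/2)` is the branch of
`u^{-1/2}` continued from `t₀`. Since `ωs = Im exp g` and `Im g` is strictly increasing, the zeros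
of `s` are the passages of `Im g` through multiples of `π`, and the index is `⌊Im g / π⌋`. With `2ω
/ det Λ = is/A`, this matches the continued branch with the principal root (`vacuum_branch`). Zeros
of `s` are isolated, and the amplitude is continuous there. -/

theorem IsSolution.wronskian_eq {κ : ℝ → ℝ} {I : Set ℝ} (hI : IsOpen I) (hI' : I.OrdConnected)
    {u v : ℝ → ℝ} (hu : IsSolution κ I u) (hv : IsSolution κ I v) {a b : ℝ} (ha : a ∈ I)
    (hb : b ∈ I) : u a * deriv v a - deriv u a * v a = u b * deriv v b - deriv u b * v b := by
  have hd : ∀ x ∈ I, HasDerivAt (fun y => u y * deriv v y - deriv u y * v y) 0 x := by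
    intro x hx
    obtain ⟨hu1, hu2⟩ := hu x hx
    obtain ⟨hv1, hv2⟩ := hv x hx
    refine ((hu1.hasDerivAt.mul hv2).sub (hu2.mul hv1.hasDerivAt)).congr_deriv ?_
    ring
  exact hI.is_const_of_deriv_eq_zero hI'.isPreconnected
    (fun x hx => (hd x hx).differentiableAt.differentiableWithinAt)
    (fun x hx => (hd x hx).deriv) ha hb

section Classical

variable {κ : ℝ → ℝ} {I : Set ℝ} {c s : ℝ → ℝ → ℝ}

theorem IsFundamentalPair.wronskian_eq_one (h : IsFundamentalPair κ I c s) (hI : IsOpen I)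
    (hI' : I.OrdConnected) {t t₀ : ℝ} (ht : t ∈ I) (ht₀ : t₀ ∈ I) :
    c t t₀ * dot s t t₀ - dot c t t₀ * s t t₀ = 1 := by
  have := (h.c_solution t₀ ht₀).wronskian_eq hI hI' (h.s_solution t₀ ht₀) ht ht₀
  rw [h.c_initial t₀ ht₀, h.c_deriv_initial t₀ ht₀, h.s_initial t₀ ht₀,
    h.s_deriv_initial t₀ ht₀] at this
  simpa [dot] using this

/-- In this and the next three lemmas, the Wronskian of a solution based at `t` with one based at
`t₀` is evaluated at both times, where one of the two has known Cauchy data. No regularity in the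
second time argument is needed. -/
theorem IsFundamentalPair.c_swap (h : IsFundamentalPair κ I c s) (hI : IsOpen I)
    (hI' : I.OrdConnected) {t t₀ : ℝ} (ht : t ∈ I) (ht₀ : t₀ ∈ I) : c t₀ t = dot s t t₀ := by
  have := (h.c_solution t ht).wronskian_eq hI hI' (h.s_solution t₀ ht₀) ht₀ ht
  rw [h.c_initial t ht, h.c_deriv_initial t ht, h.s_initial t₀ ht₀,
    h.s_deriv_initial t₀ ht₀] at this
  simpa [dot] using this

theorem IsFundamentalPair.s_swap (h : IsFundamentalPair κ I c s) (hI : IsOpen I)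
    (hI' : I.OrdConnected) {t t₀ : ℝ} (ht : t ∈ I) (ht₀ : t₀ ∈ I) : s t₀ t = -s t t₀ := by
  have := (h.s_solution t ht).wronskian_eq hI hI' (h.s_solution t₀ ht₀) ht₀ ht
  rw [h.s_initial t ht, h.s_deriv_initial t ht, h.s_initial t₀ ht₀,
    h.s_deriv_initial t₀ ht₀] at this
  simpa using this

theorem IsFundamentalPair.dot_c_swap (h : IsFundamentalPair κ I c s) (hI : IsOpen I)
    (hI' : I.OrdConnected) {t t₀ : ℝ} (ht : t ∈ I) (ht₀ : t₀ ∈ I) :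
    dot c t₀ t = -dot c t t₀ := by
  have := (h.c_solution t ht).wronskian_eq hI hI' (h.c_solution t₀ ht₀) ht₀ ht
  rw [h.c_initial t ht, h.c_deriv_initial t ht, h.c_initial t₀ ht₀,
    h.c_deriv_initial t₀ ht₀] at this
  simp only [dot]
  linarith

theorem IsFundamentalPair.dot_s_swap (h : IsFundamentalPair κ I c s) (hI : IsOpen I)
    (hI' : I.OrdConnected) {t t₀ : ℝ} (ht : t ∈ I) (ht₀ : t₀ ∈ I) :
    dot s t₀ t = c t t₀ := by
  have := (h.s_solution t ht).wronskian_eq hI hI' (h.c_solution t₀ ht₀) ht₀ ht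
  rw [h.s_initial t ht, h.s_deriv_initial t ht, h.c_initial t₀ ht₀,
    h.c_deriv_initial t₀ ht₀] at this
  simp only [dot]
  linarith

/-! ### The complex solution `c + iωs` -/

/-- The complex solution `u(t, t₀) = c(t, t₀) + iω s(t, t₀)`. -/
noncomputable def complexSol (c s : ℝ → ℝ → ℝ) (ω t₀ t : ℝ) : ℂ :=
  (c t t₀ : ℂ) + Complex.I * (ω * s t t₀ : ℝ)

/-- The derivative of `complexSol` in `t`. -/
noncomputable def complexSolDot (c s : ℝ → ℝ → ℝ) (ω t₀ t : ℝ) : ℂ :=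
  (dot c t t₀ : ℂ) + Complex.I * (ω * dot s t t₀ : ℝ)

theorem IsFundamentalPair.hasDerivAt_complexSol (h : IsFundamentalPair κ I c s) (ω : ℝ) {t t₀ : ℝ}
    (ht : t ∈ I) (ht₀ : t₀ ∈ I) :
    HasDerivAt (complexSol c s ω t₀) (complexSolDot c s ω t₀ t) t :=
  ((h.c_solution t₀ ht₀ t ht).1.hasDerivAt.ofReal_comp).add
    ((((h.s_solution t₀ ht₀ t ht).1.hasDerivAt.const_mul ω).ofReal_comp).const_mul Complex.I)

theorem IsFundamentalPair.hasDerivAt_complexSolDot (h : IsFundamentalPair κ I c s) (ω : ℝ)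
    {t t₀ : ℝ} (ht : t ∈ I) (ht₀ : t₀ ∈ I) :
    HasDerivAt (complexSolDot c s ω t₀) (-(κ t * complexSol c s ω t₀ t)) t := by
  refine HasDerivAt.congr_deriv (((h.c_solution t₀ ht₀ t ht).2.ofReal_comp).add
    ((((h.s_solution t₀ ht₀ t ht).2.const_mul ω).ofReal_comp).const_mul Complex.I)) ?_
  simp only [complexSol]
  push_cast
  ring

theorem IsFundamentalPair.complexSol_ne_zero (h : IsFundamentalPair κ I c s) (hI : IsOpen I)
    (hI' : I.OrdConnected) {ω : ℝ} (hω : 0 < ω) {t t₀ : ℝ} (ht : t ∈ I) (ht₀ : t₀ ∈ I) :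
    complexSol c s ω t₀ t ≠ 0 := by
  intro h0
  have h1 : c t t₀ = 0 := by simpa [complexSol] using congrArg Complex.re h0
  have h2 : s t t₀ = 0 := by simpa [complexSol, hω.ne'] using congrArg Complex.im h0
  have := h.wronskian_eq_one hI hI' ht ht₀
  simp [h1, h2] at this

/-- The real part of `-iu'/u` is `ω/|u|²`, and its imaginary part is that of `u'/u`. -/
theorem IsFundamentalPair.im_complexSolDot_div (h : IsFundamentalPair κ I c s) (hI : IsOpen I)
    (hI' : I.OrdConnected) {ω t t₀ : ℝ} (ht : t ∈ I) (ht₀ : t₀ ∈ I) :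
    (complexSolDot c s ω t₀ t / complexSol c s ω t₀ t).im =
      ω / ‖complexSol c s ω t₀ t‖ ^ 2 := by
  rw [Complex.div_im, ← Complex.normSq_eq_norm_sq]
  have := h.wronskian_eq_one hI hI' ht ht₀
  have e : (complexSolDot c s ω t₀ t).im * (complexSol c s ω t₀ t).re -
      (complexSolDot c s ω t₀ t).re * (complexSol c s ω t₀ t).im = ω := by
    simp [complexSolDot, complexSol]
    linear_combination ω * this
  rw [← sub_div, e]

/-- The logarithm `∫ u'/u` of the complex solution. -/
noncomputable def logSol (c s : ℝ → ℝ → ℝ) (ω t₀ t : ℝ) : ℂ :=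
  ∫ τ in t₀..t, complexSolDot c s ω t₀ τ / complexSol c s ω t₀ τ

theorem IsFundamentalPair.hasDerivAt_logSol (h : IsFundamentalPair κ I c s) (hI : IsOpen I)
    (hI' : I.OrdConnected) {ω : ℝ} (hω : 0 < ω) {t t₀ : ℝ} (ht : t ∈ I) (ht₀ : t₀ ∈ I) :
    HasDerivAt (logSol c s ω t₀) (complexSolDot c s ω t₀ t / complexSol c s ω t₀ t) t := by
  have hc : ContinuousOn (fun τ => complexSolDot c s ω t₀ τ / complexSol c s ω t₀ τ) I :=
    fun x hx => ((h.hasDerivAt_complexSolDot ω hx ht₀).continuousAt.div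
      (h.hasDerivAt_complexSol ω hx ht₀).continuousAt
      (h.complexSol_ne_zero hI hI' hω hx ht₀)).continuousWithinAt
  exact intervalIntegral.integral_hasDerivAt_right
    (hc.mono (hI'.uIcc_subset ht₀ ht)).intervalIntegrable
    (hc.stronglyMeasurableAtFilter hI t ht) (hc.continuousAt (hI.mem_nhds ht))

/-- The product `exp(-g) u` has zero derivative and equals 1 at `t₀`. Consequently `exp(-g/2)` is a
differentiable branch of `u^{-1/2}` on all of `I`. -/
theorem IsFundamentalPair.exp_logSol (h : IsFundamentalPair κ I c s) (hI : IsOpen I)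
    (hI' : I.OrdConnected) {ω : ℝ} (hω : 0 < ω) {t t₀ : ℝ} (ht : t ∈ I) (ht₀ : t₀ ∈ I) :
    Complex.exp (logSol c s ω t₀ t) = complexSol c s ω t₀ t := by
  have hd : ∀ x ∈ I, HasDerivAt
      (fun y => Complex.exp (-logSol c s ω t₀ y) * complexSol c s ω t₀ y) 0 x := by
    intro x hx
    have hne := h.complexSol_ne_zero hI hI' hω hx ht₀
    refine HasDerivAt.congr_deriv ((h.hasDerivAt_logSol hI hI' hω hx ht₀).fun_neg.cexp.mul
      (h.hasDerivAt_complexSol ω hx ht₀)) ?_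
    field_simp
    ring
  have := hI.is_const_of_deriv_eq_zero hI'.isPreconnected
    (fun x hx => (hd x hx).differentiableAt.differentiableWithinAt)
    (fun x hx => (hd x hx).deriv) ht ht₀
  have h0 : complexSol c s ω t₀ t₀ = 1 := by
    simp [complexSol, h.c_initial t₀ ht₀, h.s_initial t₀ ht₀]
  have h1 : logSol c s ω t₀ t₀ = 0 := by simp [logSol]
  simp only [h0, h1, neg_zero, Complex.exp_zero, mul_one] at this
  rw [Complex.exp_neg] at this
  field_simp at this
  exact this.symm

end Classical

/-! ### Gaussian Schwartz functions -/

/-- The function `q ↦ p(q) exp(-a q²)`. -/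
noncomputable def gaussFun (a : ℂ) (p : Polynomial ℂ) (q : ℝ) : ℂ :=
  p.eval (q : ℂ) * Complex.exp (-a * (q : ℂ) ^ 2)

/-- The polynomial factor of the derivative of `gaussFun a p`. -/
noncomputable def gaussDeriv (a : ℂ) (p : Polynomial ℂ) : Polynomial ℂ :=
  Polynomial.derivative p - Polynomial.C (2 * a) * Polynomial.X * p

theorem hasDerivAt_gaussFun (a : ℂ) (p : Polynomial ℂ) (q : ℝ) :
    HasDerivAt (gaussFun a p) (gaussFun a (gaussDeriv a p) q) q := by
  have h1 : HasDerivAt (fun q : ℝ => (q : ℂ)) 1 q := Complex.ofRealCLM.hasDerivAt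
  have h2 : HasDerivAt (fun q : ℝ => p.eval (q : ℂ)) ((Polynomial.derivative p).eval (q : ℂ)) q := by
    simpa using (p.hasDerivAt (q : ℂ)).comp_ofReal
  refine HasDerivAt.congr_deriv (h2.mul ((h1.pow 2).const_mul (-a)).cexp) ?_
  simp only [gaussFun, gaussDeriv, Polynomial.eval_sub, Polynomial.eval_mul, Polynomial.eval_C,
    Polynomial.eval_X, Pi.pow_apply]
  push_cast
  ring

theorem deriv_gaussFun (a : ℂ) (p : Polynomial ℂ) :
    deriv (gaussFun a p) = gaussFun a (gaussDeriv a p) :=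
  funext fun q => (hasDerivAt_gaussFun a p q).deriv

theorem iteratedDeriv_gaussFun (a : ℂ) (p : Polynomial ℂ) (n : ℕ) :
    iteratedDeriv n (gaussFun a p) = gaussFun a ((gaussDeriv a)^[n] p) := by
  induction n generalizing p with
  | zero => simp
  | succ n ih => rw [iteratedDeriv_succ', deriv_gaussFun, ih, Function.iterate_succ_apply]

theorem contDiff_gaussFun (a : ℂ) (p : Polynomial ℂ) {n : WithTop ℕ∞} :
    ContDiff ℝ n (gaussFun a p) := by
  have h1 : ContDiff ℝ n (fun q : ℝ => (q : ℂ)) := Complex.ofRealCLM.contDiff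
  have h2 : ContDiff ℝ n (fun q : ℝ => p.eval (q : ℂ)) :=
    ((Differentiable.contDiff (E := ℂ) p.differentiable).restrict_scalars ℝ).comp h1
  exact h2.mul (contDiff_const.mul (h1.pow 2)).cexp

theorem norm_gaussFun (a : ℂ) (p : Polynomial ℂ) (q : ℝ) :
    ‖gaussFun a p q‖ = ‖p.eval (q : ℂ)‖ * Real.exp (-a.re * q ^ 2) := by
  rw [gaussFun, norm_mul, Complex.norm_exp]
  congr 3
  rw [← Complex.ofReal_pow, Complex.re_mul_ofReal]
  simp

theorem exists_norm_gaussFun_le {a : ℂ} (ha : 0 < a.re) (p : Polynomial ℂ) :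
    ∃ C : ℝ, ∀ q : ℝ, ‖gaussFun a p q‖ ≤ C := by
  induction p using Polynomial.induction_on' with
  | add p r hp hr =>
    obtain ⟨C, hC⟩ := hp
    obtain ⟨D, hD⟩ := hr
    refine ⟨C + D, fun q => ?_⟩
    have : gaussFun a (p + r) q = gaussFun a p q + gaussFun a r q := by simp [gaussFun, add_mul]
    exact this ▸ (norm_add_le _ _).trans (add_le_add (hC q) (hD q))
  | monomial k z =>
    -- The bound combines `|q|^k ≤ 1 + q^{2k}` with `x^k exp(-x) ≤ k!` at `x = a.re * q²`.
    refine ⟨‖z‖ * (1 + k.factorial / a.re ^ k), fun q => ?_⟩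
    rw [norm_gaussFun]
    simp only [Polynomial.eval_monomial, norm_mul, norm_pow, Complex.norm_real, mul_assoc]
    refine mul_le_mul_of_nonneg_left ?_ (norm_nonneg z)
    have h0 : 0 ≤ a.re * q ^ 2 := by positivity
    have h1 := Real.pow_div_factorial_le_exp _ h0 k
    have h2 : Real.exp (-a.re * q ^ 2) ≤ 1 := Real.exp_le_one_iff.2 (by linarith)
    have h3 : |q| ^ k ≤ 1 + (q ^ 2) ^ k := by
      rw [← sq_abs q, ← pow_mul, mul_comm 2 k, pow_mul]
      nlinarith [sq_nonneg (|q| ^ k - 1), sq_nonneg (|q| ^ k)]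
    have h4 : (q ^ 2) ^ k * Real.exp (-a.re * q ^ 2) ≤ k.factorial / a.re ^ k := by
      rw [neg_mul, Real.exp_neg, ← div_eq_mul_inv, div_le_div_iff₀ (Real.exp_pos _) (by positivity)]
      rw [mul_pow, div_le_iff₀ (by positivity)] at h1
      linarith
    calc ‖q‖ ^ k * Real.exp (-a.re * q ^ 2) ≤ (1 + (q ^ 2) ^ k) * Real.exp (-a.re * q ^ 2) :=
          mul_le_mul_of_nonneg_right h3 (Real.exp_pos _).le
      _ ≤ 1 + k.factorial / a.re ^ k := by rw [add_mul, one_mul]; exact add_le_add h2 h4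

/-- The Schwartz function `q ↦ p(q) exp(-a q²)` for `Re a > 0` (and `0` otherwise). -/
noncomputable def gaussSchwartz (a : ℂ) (p : Polynomial ℂ) : 𝓢(ℝ, ℂ) :=
  open Classical in
  if ha : 0 < a.re then
    { toFun := gaussFun a p
      smooth' := contDiff_gaussFun a p
      decay' := fun k n => by
        -- A derivative weighted by `q^k` is again a polynomial times the same Gaussian, so every
        -- Schwartz seminorm reduces to boundedness.
        obtain ⟨C, hC⟩ := exists_norm_gaussFun_le ha (Polynomial.X ^ k * (gaussDeriv a)^[n] p)
        refine ⟨C, fun q => le_trans (le_of_eq ?_) (hC q)⟩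
        rw [norm_iteratedFDeriv_eq_norm_iteratedDeriv, iteratedDeriv_gaussFun, norm_gaussFun,
          norm_gaussFun]
        simp [mul_assoc] }
  -- The default value makes the family total in `a`, so it can be differentiated in the parameter
  -- without carrying positivity proofs.
  else 0

theorem coe_gaussSchwartz {a : ℂ} (ha : 0 < a.re) (p : Polynomial ℂ) :
    ⇑(gaussSchwartz a p) = gaussFun a p := by
  simp only [gaussSchwartz, ha, dif_pos]
  rfl

theorem gaussSchwartz_smul (a : ℂ) (z : ℂ) (p : Polynomial ℂ) :
    gaussSchwartz a (z • p) = z • gaussSchwartz a p := by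
  by_cases ha : 0 < a.re
  · ext q
    simp [coe_gaussSchwartz ha, gaussFun, mul_assoc]
  · simp [gaussSchwartz, ha]

theorem opQ_gaussSchwartz {a : ℂ} (ha : 0 < a.re) (p : Polynomial ℂ) :
    opQ (gaussSchwartz a p) = gaussSchwartz a (Polynomial.X * p) := by
  ext q
  simp [opQ_apply, coe_gaussSchwartz ha, gaussFun, mul_assoc]

theorem opP_gaussSchwartz {a : ℂ} (ha : 0 < a.re) (p : Polynomial ℂ) :
    opP (gaussSchwartz a p) = gaussSchwartz a ((-Complex.I) • gaussDeriv a p) := by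
  ext q
  rw [opP_apply, coe_gaussSchwartz ha, deriv_gaussFun, gaussSchwartz_smul, smul_apply,
    coe_gaussSchwartz ha, smul_eq_mul]

/-- Only `exp(-a q²)` and `q² exp(-a q²)` appear, the latter being minus the derivative of the
former in `a`: this is why the Gaussian ansatz closes. -/
theorem hamiltonian_gaussSchwartz_one (κ : ℝ → ℝ) (t : ℝ) {a : ℂ} (ha : 0 < a.re) :
    hamiltonian κ t (gaussSchwartz a 1) =
      a • gaussSchwartz a 1 + (κ t / 2 - 2 * a ^ 2) • gaussSchwartz a (Polynomial.X ^ 2) := by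
  rw [hamiltonian]
  simp only [LinearMap.smul_apply, LinearMap.add_apply, LinearMap.comp_apply,
    opQ_gaussSchwartz ha, opP_gaussSchwartz ha]
  ext q
  simp only [smul_apply, add_apply, coe_gaussSchwartz ha, gaussFun,
    gaussDeriv]
  simp
  ring_nf
  simp
  ring

/-! ### Dependence on the parameter in `L²` -/

theorem toLp_smul_schwartz (z : ℂ) (f : 𝓢(ℝ, ℂ)) : (z • f).toLp 2 volume = (z • f.toLp 2 volume : L2) :=
  (SchwartzMap.toLpCLM ℂ ℂ 2 volume).map_smul z f

theorem toLp_add_schwartz (f g : 𝓢(ℝ, ℂ)) : (f + g).toLp 2 volume = (f.toLp 2 volume + g.toLp 2 volume : L2) :=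
  (SchwartzMap.toLpCLM ℂ ℂ 2 volume).map_add f g

theorem toLp_sub_schwartz (f g : 𝓢(ℝ, ℂ)) : (f - g).toLp 2 volume = (f.toLp 2 volume - g.toLp 2 volume : L2) :=
  (SchwartzMap.toLpCLM ℂ ℂ 2 volume).map_sub f g

theorem norm_toLp_le_of_norm_le (f g : 𝓢(ℝ, ℂ)) {C : ℝ} (h : ∀ q, ‖f q‖ ≤ C * ‖g q‖) :
    ‖(f.toLp 2 volume : L2)‖ ≤ C * ‖(g.toLp 2 volume : L2)‖ := by
  refine Lp.norm_le_mul_norm_of_ae_le_mul ?_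
  filter_upwards [f.coeFn_toLp 2, g.coeFn_toLp 2] with q hf hg
  rw [hf, hg]
  exact h q

/-- The second-order Taylor remainder of the exponential is bounded pointwise by `|b - a|² q⁴
exp(-(Re a / 2) q²)` for `|b - a| < Re a / 2`. Its `L²` norm is therefore `O(|b - a|²)`. -/
theorem hasDerivAt_toLp_gaussSchwartz {a : ℂ} (ha : 0 < a.re) :
    HasDerivAt (fun b : ℂ => ((gaussSchwartz b 1).toLp 2 volume : L2))
      ((gaussSchwartz a (-Polynomial.X ^ 2)).toLp 2 volume) a := by
  set g : L2 := (gaussSchwartz ((a.re / 2 : ℝ) : ℂ) (Polynomial.X ^ 4)).toLp 2 volume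
  have hg : 0 < (((a.re / 2 : ℝ) : ℂ)).re := by simpa using ha
  rw [hasDerivAt_iff_isLittleO]
  have hO : (fun b : ℂ => ((gaussSchwartz b 1).toLp 2 volume : L2) - (gaussSchwartz a 1).toLp 2 volume -
      (b - a) • ((gaussSchwartz a (-Polynomial.X ^ 2)).toLp 2 volume : L2)) =O[𝓝 a]
      fun b => (b - a) ^ 2 := by
    refine Asymptotics.IsBigO.of_bound ‖g‖ ?_
    filter_upwards [Metric.ball_mem_nhds a (half_pos ha)] with b hb
    rw [Metric.mem_ball, dist_eq_norm] at hb
    have hb' : 0 < b.re := by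
      have := (abs_le.1 (Complex.abs_re_le_norm (b - a))).1
      simp only [Complex.sub_re] at this
      linarith
    rw [← toLp_sub_schwartz, ← toLp_smul_schwartz, ← toLp_sub_schwartz, mul_comm]
    refine norm_toLp_le_of_norm_le _ _ fun q => ?_
    have hδ := Complex.norm_exp_sub_sum_le_norm_mul_exp (-(b - a) * (q : ℂ) ^ 2) 2
    have e : (gaussSchwartz b 1 - gaussSchwartz a 1 -
        (b - a) • gaussSchwartz a (-Polynomial.X ^ 2)) q =
        Complex.exp (-a * (q : ℂ) ^ 2) * (Complex.exp (-(b - a) * (q : ℂ) ^ 2) -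
          ∑ m ∈ Finset.range 2, (-(b - a) * (q : ℂ) ^ 2) ^ m / m.factorial) := by
      rw [mul_sub, ← Complex.exp_add]
      simp only [sub_apply, smul_apply, coe_gaussSchwartz ha,
        coe_gaussSchwartz hb', gaussFun, Finset.sum_range_succ]
      simp
      ring_nf
    rw [e, norm_mul, coe_gaussSchwartz hg, norm_gaussFun]
    have hn : ‖-(b - a) * (q : ℂ) ^ 2‖ = ‖b - a‖ * q ^ 2 := by
      rw [norm_mul, norm_neg]
      simp
    rw [hn] at hδ
    have hx : ‖Complex.exp (-a * (q : ℂ) ^ 2)‖ = Real.exp (-a.re * q ^ 2) := by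
      simpa [gaussFun] using norm_gaussFun a 1 q
    rw [hx]
    calc Real.exp (-a.re * q ^ 2) * _
        ≤ Real.exp (-a.re * q ^ 2) * ((‖b - a‖ * q ^ 2) ^ 2 * Real.exp (‖b - a‖ * q ^ 2)) :=
          mul_le_mul_of_nonneg_left hδ (Real.exp_pos _).le
      _ = ‖(b - a) ^ 2‖ * (q ^ 4 * Real.exp (-a.re * q ^ 2 + ‖b - a‖ * q ^ 2)) := by
          rw [Real.exp_add, norm_pow]; ring
      _ ≤ ‖(b - a) ^ 2‖ * (q ^ 4 * Real.exp (-(a.re / 2) * q ^ 2)) := by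
          gcongr
          nlinarith [sq_nonneg q]
      _ = _ := by
          have : |q| ^ 4 = q ^ 4 := by rw [← abs_pow, abs_of_nonneg (by positivity)]
          simp [this]
  refine hO.trans_isLittleO ?_
  have : (fun b : ℂ => (b - a) ^ 2) = fun b => (b - a) * (b - a) := by ext; ring
  rw [this]
  refine Asymptotics.IsBigO.mul_isLittleO (Asymptotics.isBigO_refl _ _)
    (g₂ := fun _ => (1 : ℂ)) ?_ |>.trans_isBigO (by simpa using Asymptotics.isBigO_refl _ _)
  refine (Asymptotics.isLittleO_one_iff ℂ).2 ?_
  exact (continuous_id.sub continuous_const).tendsto' _ _ (sub_self a)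

/-! ### Uniqueness of the evolution along a strong solution -/

/-- A product rule for strongly differentiable `x` and merely weakly controlled `v`. Write `x τ = x
t + (τ - t) x' + o(τ - t)` and pair with `v τ`: the first term is `hd`, the second needs only
continuity of `⟪x', v⟫`, the third only the bound `M`. -/
theorem hasDerivAt_inner_of_weak {E : Type*} [NormedAddCommGroup E] [InnerProductSpace ℂ E]
    [NormedSpace ℝ E] [IsScalarTower ℝ ℂ E] {x v : ℝ → E} {x' : E} {d : ℂ} {t M : ℝ}
    (hx : HasDerivAt x x' t) (hv : ∀ τ, ‖v τ‖ ≤ M)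
    (hd : HasDerivAt (fun τ => ⟪x t, v τ⟫_ℂ) d t)
    (hc : ContinuousAt (fun τ => ⟪x', v τ⟫_ℂ) t) :
    HasDerivAt (fun τ => ⟪x τ, v τ⟫_ℂ) (⟪x', v t⟫_ℂ + d) t := by
  have h2 : HasDerivAt (fun τ => ((τ - t : ℝ) : ℂ) * ⟪x', v τ⟫_ℂ) ⟪x', v t⟫_ℂ t := by
    rw [hasDerivAt_iff_isLittleO]
    have h0 : (fun τ => ⟪x', v τ⟫_ℂ - ⟪x', v t⟫_ℂ) =o[𝓝 t] fun _ => (1 : ℝ) :=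
      (Asymptotics.isLittleO_one_iff ℝ).2 (by simpa using hc.sub_const ⟪x', v t⟫_ℂ)
    have h1 : (fun τ => ((τ - t : ℝ) : ℂ)) =O[𝓝 t] fun τ => τ - t :=
      Asymptotics.IsBigO.of_bound 1 (Eventually.of_forall fun τ => by rw [Complex.norm_real, one_mul])
    refine (h1.mul_isLittleO h0).congr (fun τ => ?_) (fun τ => by simp)
    simp
    ring
  have h3 : HasDerivAt (fun τ => ⟪x τ - x t - (τ - t) • x', v τ⟫_ℂ) 0 t := by
    rw [hasDerivAt_iff_isLittleO]
    have h0 := hasDerivAt_iff_isLittleO.1 hx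
    refine Asymptotics.IsBigO.trans_isLittleO (Asymptotics.IsBigO.of_bound M ?_) h0
    refine Eventually.of_forall fun τ => ?_
    simp only [sub_self, zero_smul, inner_zero_left, sub_zero, smul_zero]
    rw [mul_comm]
    exact (norm_inner_le_norm _ _).trans (mul_le_mul_of_nonneg_left (hv τ) (norm_nonneg _))
  refine HasDerivAt.congr_deriv (((hd.add h2).add h3).congr_of_eventuallyEq
    (Eventually.of_forall fun τ => ?_)) (by ring)
  have e : (τ - t) • x' = ((τ - t : ℝ) : ℂ) • x' := (algebraMap_smul ℂ (τ - t) x').symm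
  simp only [Pi.add_apply, inner_sub_left, e, inner_smul_left, Complex.conj_ofReal]
  ring

/-- The two contributions to the derivative are `i⟪Hχ, v⟫` and `-i⟪Hχ, v⟫`. The weak equation is
used twice, with the frozen test vector `χ τ` for the derivative and with `H χ τ`, again Schwartz,
for continuity. -/
theorem IsEvolution.inner_eq_of_strong_solution {κ : ℝ → ℝ} {I : Set ℝ}
    {U : ℝ → ℝ → (L2 ≃ₗᵢ[ℂ] L2)} (hU : IsEvolution κ I U) (hI : IsOpen I) (hI' : I.OrdConnected)
    {χ : ℝ → 𝓢(ℝ, ℂ)}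
    (hχ : ∀ t ∈ I, HasDerivAt (fun τ => ((χ τ).toLp 2 volume : L2))
      (-Complex.I • ((hamiltonian κ t (χ t)).toLp 2 volume : L2)) t)
    (ψ : 𝓢(ℝ, ℂ)) {t t₀ : ℝ} (ht : t ∈ I) (ht₀ : t₀ ∈ I) :
    ⟪(χ t).toLp 2 volume, U t t₀ (ψ.toLp 2 volume)⟫_ℂ =
      ⟪(χ t₀).toLp 2 volume, (ψ.toLp 2 volume : L2)⟫_ℂ := by
  have hd : ∀ τ ∈ I, HasDerivAt
      (fun τ => ⟪((χ τ).toLp 2 volume : L2), U τ t₀ (ψ.toLp 2 volume)⟫_ℂ) 0 τ := by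
    intro τ hτ
    have := hasDerivAt_inner_of_weak (v := fun τ => U τ t₀ (ψ.toLp 2 volume))
      (M := ‖(ψ.toLp 2 volume : L2)‖) (hχ τ hτ) (fun r => (LinearIsometryEquiv.norm_map _ _).le)
      (hU.schrodinger t₀ ht₀ τ hτ (χ τ) ψ) (by
        simp only [inner_smul_left]
        exact (hU.schrodinger t₀ ht₀ τ hτ _ ψ).continuousAt.const_mul _)
    refine this.congr_deriv ?_
    rw [inner_smul_left]
    simp
  have := hI.is_const_of_deriv_eq_zero hI'.isPreconnected
    (fun x hx => (hd x hx).differentiableAt.differentiableWithinAt)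
    (fun x hx => (hd x hx).deriv) ht ht₀
  simpa only [hU.initial t₀ ht₀] using this

/-- Taking `ψ = χ t₀` gives two unit vectors with inner product 1, the equality case of
Cauchy–Schwarz. -/
theorem IsEvolution.apply_eq_of_strong_solution {κ : ℝ → ℝ} {I : Set ℝ}
    {U : ℝ → ℝ → (L2 ≃ₗᵢ[ℂ] L2)} (hU : IsEvolution κ I U) (hI : IsOpen I) (hI' : I.OrdConnected)
    {χ : ℝ → 𝓢(ℝ, ℂ)}
    (hχ : ∀ t ∈ I, HasDerivAt (fun τ => ((χ τ).toLp 2 volume : L2))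
      (-Complex.I • ((hamiltonian κ t (χ t)).toLp 2 volume : L2)) t)
    (hn : ∀ t ∈ I, ‖((χ t).toLp 2 volume : L2)‖ = 1) {t t₀ : ℝ} (ht : t ∈ I) (ht₀ : t₀ ∈ I) :
    U t t₀ ((χ t₀).toLp 2 volume) = (χ t).toLp 2 volume := by
  have h := hU.inner_eq_of_strong_solution hI hI' hχ (χ t₀) ht ht₀
  rw [inner_self_eq_norm_sq_to_K, hn t₀ ht₀] at h
  exact ((inner_eq_one_iff_of_norm_eq_one (𝕜 := ℂ) (hn t ht)
    (by rw [LinearIsometryEquiv.norm_map, hn t₀ ht₀])).1 (by simpa using h)).symm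

/-! ### Gaussian integrals -/

/-- The integral `∫ p(q) exp(-a q²) dq`. -/
noncomputable def gaussInt (a : ℂ) (p : Polynomial ℂ) : ℂ := ∫ q : ℝ, gaussFun a p q

theorem integrable_gaussFun {a : ℂ} (ha : 0 < a.re) (p : Polynomial ℂ) :
    Integrable (gaussFun a p) :=
  coe_gaussSchwartz ha p ▸ (gaussSchwartz a p).integrable

theorem gaussInt_sub {a : ℂ} (ha : 0 < a.re) (p r : Polynomial ℂ) :
    gaussInt a (p - r) = gaussInt a p - gaussInt a r := by
  rw [gaussInt, gaussInt, gaussInt,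
    ← integral_sub (integrable_gaussFun ha p) (integrable_gaussFun ha r)]
  exact integral_congr_ae (Eventually.of_forall fun q => by simp [gaussFun, sub_mul])

theorem gaussInt_C_mul (a z : ℂ) (p : Polynomial ℂ) :
    gaussInt a (Polynomial.C z * p) = z * gaussInt a p := by
  rw [gaussInt, gaussInt, ← integral_const_mul]
  exact integral_congr_ae (Eventually.of_forall fun q => by simp [gaussFun, mul_assoc])

theorem gaussInt_one {a : ℂ} (ha : 0 < a.re) :
    gaussInt a 1 = (Real.pi / a) ^ (1 / 2 : ℂ) := by
  rw [← integral_gaussian_complex ha]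
  simp [gaussInt, gaussFun]

theorem gaussInt_derivative {a : ℂ} (ha : 0 < a.re) (p : Polynomial ℂ) :
    gaussInt a (Polynomial.derivative p) = 2 * a * gaussInt a (Polynomial.X * p) := by
  have h := integral_eq_zero_of_hasDerivAt_of_integrable (hasDerivAt_gaussFun a p)
    (integrable_gaussFun ha _) (integrable_gaussFun ha p)
  change gaussInt a (gaussDeriv a p) = 0 at h
  rw [gaussDeriv, gaussInt_sub ha, mul_assoc, gaussInt_C_mul] at h
  linear_combination h

theorem inner_gaussSchwartz {a b : ℂ} (ha : 0 < a.re) (hb : 0 < b.re) (p r : Polynomial ℂ) :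
    ⟪((gaussSchwartz a p).toLp 2 volume : L2), (gaussSchwartz b r).toLp 2 volume⟫_ℂ =
      gaussInt ((starRingEnd ℂ) a + b) (p.map (starRingEnd ℂ) * r) := by
  rw [MeasureTheory.L2.inner_def, gaussInt]
  refine integral_congr_ae ?_
  filter_upwards [(gaussSchwartz a p).coeFn_toLp 2 volume,
    (gaussSchwartz b r).coeFn_toLp 2 volume] with q h1 h2
  have hp : (starRingEnd ℂ) (p.eval (q : ℂ)) = (p.map (starRingEnd ℂ)).eval (q : ℂ) := by
    rw [Polynomial.eval_map, Polynomial.eval, Polynomial.hom_eval₂, RingHom.comp_id,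
      Complex.conj_ofReal]
  rw [h1, h2, coe_gaussSchwartz ha, coe_gaussSchwartz hb, RCLike.inner_apply]
  simp only [gaussFun, map_mul, ← Complex.exp_conj, hp, Polynomial.eval_mul, map_neg, map_pow,
    Complex.conj_ofReal, neg_add, add_mul, Complex.exp_add]
  ring

/-! ### Hermite polynomials -/

/-- The polynomial `Hₙ(√ω q)` with complex coefficients. -/
noncomputable def hermiteScaled (ω : ℝ) (n : ℕ) : Polynomial ℂ :=
  ((hermiteH n).map Complex.ofRealHom).comp (Polynomial.C (Real.sqrt ω : ℂ) * Polynomial.X)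

theorem hermiteScaled_zero (ω : ℝ) : hermiteScaled ω 0 = 1 := by
  simp [hermiteScaled, hermiteH]

theorem derivative_hermiteH_succ (n : ℕ) :
    Polynomial.derivative (hermiteH (n + 1)) = (2 * (n + 1) : ℝ) • hermiteH n := by
  have hC : Polynomial.C (2 : ℝ) = 2 := rfl
  induction n with
  | zero => simp [hermiteH, Polynomial.smul_eq_C_mul, hC]
  | succ n ih =>
    rw [hermiteH, Polynomial.derivative_sub, ih, Polynomial.derivative_smul,
      Polynomial.derivative_mul, ih]
    have : hermiteH (n + 1) = 2 * Polynomial.X * hermiteH n - Polynomial.derivative (hermiteH n) :=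
      rfl
    simp only [Polynomial.smul_eq_C_mul]
    rw [show Polynomial.derivative (hermiteH n) = 2 * Polynomial.X * hermiteH n - hermiteH (n + 1)
      by rw [this]; ring]
    simp [hC]
    ring

theorem derivative_hermiteScaled (ω : ℝ) (n : ℕ) :
    Polynomial.derivative (hermiteScaled ω n) = Polynomial.C (Real.sqrt ω : ℂ) *
      ((Polynomial.derivative (hermiteH n)).map Complex.ofRealHom).comp
        (Polynomial.C (Real.sqrt ω : ℂ) * Polynomial.X) := by
  rw [hermiteScaled, Polynomial.derivative_comp, Polynomial.derivative_map]
  simp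

theorem derivative_hermiteScaled_succ (ω : ℝ) (n : ℕ) :
    Polynomial.derivative (hermiteScaled ω (n + 1)) =
      Polynomial.C (2 * (n + 1) * Real.sqrt ω : ℂ) * hermiteScaled ω n := by
  rw [derivative_hermiteScaled, derivative_hermiteH_succ, hermiteScaled]
  simp [Polynomial.smul_eq_C_mul]
  ring

theorem hermiteScaled_succ {ω : ℝ} (hω : 0 < ω) (n : ℕ) :
    hermiteScaled ω (n + 1) =
      Polynomial.C (2 * Real.sqrt ω : ℂ) * (Polynomial.X * hermiteScaled ω n) -
      Polynomial.C ((Real.sqrt ω : ℂ)⁻¹) * Polynomial.derivative (hermiteScaled ω n) := by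
  have h : (Real.sqrt ω : ℂ)⁻¹ * (Real.sqrt ω : ℂ) = 1 :=
    inv_mul_cancel₀ (by exact_mod_cast (Real.sqrt_pos.2 hω).ne')
  have hC : Polynomial.C (2 : ℂ) = 2 := rfl
  rw [derivative_hermiteScaled, ← mul_assoc, ← mul_assoc (Polynomial.C (_)⁻¹), ← Polynomial.C_mul, h, hermiteScaled, hermiteScaled,
    hermiteH]
  simp [hC]
  left
  ring

/-- The integrals of Hermite polynomials against a Gaussian. -/
theorem gaussInt_hermiteScaled_succ {ω : ℝ} (hω : 0 < ω) {a : ℂ} (ha : 0 < a.re) (n : ℕ) :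
    gaussInt a (hermiteScaled ω (n + 1)) = (Real.sqrt ω / a - (Real.sqrt ω : ℂ)⁻¹) *
      gaussInt a (Polynomial.derivative (hermiteScaled ω n)) := by
  have ha0 : a ≠ 0 := fun h => by simp [h] at ha
  rw [hermiteScaled_succ hω, gaussInt_sub ha, gaussInt_C_mul, gaussInt_C_mul,
    gaussInt_derivative ha]
  field_simp

/-- The derivative left by integration by parts is a multiple of the preceding Hermite polynomial.
At `a = (ω + Z)/2` the factor `ω/a - 1` becomes `-B/A`. -/
theorem gaussInt_hermiteScaled_add_two {ω : ℝ} (hω : 0 < ω) {a : ℂ} (ha : 0 < a.re) (n : ℕ) :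
    gaussInt a (hermiteScaled ω (n + 2)) =
      (ω / a - 1) * (2 * (n + 1)) * gaussInt a (hermiteScaled ω n) := by
  have h : (Real.sqrt ω : ℂ) ≠ 0 := by exact_mod_cast (Real.sqrt_pos.2 hω).ne'
  have h2 : (Real.sqrt ω : ℂ) ^ 2 = ω := by exact_mod_cast Real.sq_sqrt hω.le
  have ha0 : a ≠ 0 := fun h => by simp [h] at ha
  rw [gaussInt_hermiteScaled_succ hω ha, derivative_hermiteScaled_succ, gaussInt_C_mul, ← h2]
  field_simp

theorem gaussInt_hermiteScaled_odd {ω : ℝ} (hω : 0 < ω) {a : ℂ} (ha : 0 < a.re) (n : ℕ) :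
    gaussInt a (hermiteScaled ω (2 * n + 1)) = 0 := by
  induction n with
  | zero =>
    rw [mul_zero, gaussInt_hermiteScaled_succ hω ha, hermiteScaled_zero]
    simp [gaussInt, gaussFun]
  | succ n ih =>
    rw [show 2 * (n + 1) + 1 = 2 * n + 1 + 2 by ring, gaussInt_hermiteScaled_add_two hω ha, ih,
      mul_zero]

theorem gaussInt_hermiteScaled_even {ω : ℝ} (hω : 0 < ω) {a : ℂ} (ha : 0 < a.re) (n : ℕ) :
    gaussInt a (hermiteScaled ω (2 * n)) =
      ((2 * n).factorial / n.factorial) * (ω / a - 1) ^ n * gaussInt a 1 := by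
  induction n with
  | zero => simp [hermiteScaled_zero]
  | succ n ih =>
    rw [show 2 * (n + 1) = 2 * n + 2 by ring, gaussInt_hermiteScaled_add_two hω ha, ih,
      Nat.factorial_succ, Nat.factorial_succ, Nat.factorial_succ]
    have : (n.factorial : ℂ) ≠ 0 := by exact_mod_cast n.factorial_ne_zero
    have : (n + 1 : ℂ) ≠ 0 := by exact_mod_cast n.succ_ne_zero
    push_cast
    field_simp
    ring

/-- Orthogonality of the Hermite polynomials. -/
theorem gaussInt_hermiteScaled_mul_succ {ω : ℝ} (hω : 0 < ω) (n : ℕ) (p : Polynomial ℂ) :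
    gaussInt ω (hermiteScaled ω (n + 1) * p) =
      (Real.sqrt ω : ℂ)⁻¹ * gaussInt ω (hermiteScaled ω n * Polynomial.derivative p) := by
  have hω' : 0 < ((ω : ℝ) : ℂ).re := hω
  have h : (Real.sqrt ω : ℂ) ≠ 0 := by exact_mod_cast (Real.sqrt_pos.2 hω).ne'
  have h2 : (Real.sqrt ω : ℂ) ^ 2 = ω := by exact_mod_cast Real.sq_sqrt hω.le
  have h1 := gaussInt_derivative hω' (hermiteScaled ω n * p)
  have e : hermiteScaled ω (n + 1) * p =
      Polynomial.C (2 * Real.sqrt ω : ℂ) * (Polynomial.X * (hermiteScaled ω n * p)) -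
      Polynomial.C ((Real.sqrt ω : ℂ)⁻¹) * (Polynomial.derivative (hermiteScaled ω n * p) -
        hermiteScaled ω n * Polynomial.derivative p) := by
    rw [hermiteScaled_succ hω, Polynomial.derivative_mul]
    ring
  rw [e, gaussInt_sub hω', gaussInt_C_mul, gaussInt_C_mul, gaussInt_sub hω', h1, ← h2]
  field_simp
  ring

theorem gaussInt_hermiteScaled_mul {ω : ℝ} (hω : 0 < ω) (n m : ℕ) :
    gaussInt ω (hermiteScaled ω n * hermiteScaled ω m) =
      if n = m then 2 ^ n * n.factorial * gaussInt ω 1 else 0 := by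
  have h : (Real.sqrt ω : ℂ) ≠ 0 := by exact_mod_cast (Real.sqrt_pos.2 hω).ne'
  induction n generalizing m with
  | zero =>
    cases m with
    | zero => simp [hermiteScaled_zero]
    | succ m =>
      rw [mul_comm, gaussInt_hermiteScaled_mul_succ hω, hermiteScaled_zero]
      simp [gaussInt, gaussFun]
  | succ n ih =>
    cases m with
    | zero =>
      rw [gaussInt_hermiteScaled_mul_succ hω, hermiteScaled_zero]
      simp [gaussInt, gaussFun]
    | succ m =>
      rw [gaussInt_hermiteScaled_mul_succ hω, derivative_hermiteScaled_succ, mul_left_comm,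
        gaussInt_C_mul, ih]
      by_cases hnm : n = m
      · subst hnm
        simp only [if_true, Nat.factorial_succ, pow_succ]
        push_cast
        field_simp
      · simp [hnm]

/-! ### The states `φₙ` -/

/-- The normalization constant of `φₙ`. -/
noncomputable def phiConst (ω : ℝ) (n : ℕ) : ℝ :=
  ω ^ (1 / 4 : ℝ) / Real.sqrt (2 ^ n * (n.factorial : ℝ) * Real.sqrt Real.pi)

theorem phiConst_sq {ω : ℝ} (hω : 0 < ω) (n : ℕ) :
    phiConst ω n ^ 2 = Real.sqrt (ω / Real.pi) / (2 ^ n * n.factorial) := by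
  have h : (ω ^ (1 / 4 : ℝ)) ^ 2 = Real.sqrt ω := by
    rw [← Real.rpow_natCast, ← Real.rpow_mul hω.le, Real.sqrt_eq_rpow]
    norm_num
  rw [phiConst, div_pow, h, Real.sq_sqrt (by positivity), Real.sqrt_div hω.le, div_div]
  congr 1
  ring

theorem phiConst_eq {ω : ℝ} (n : ℕ) :
    phiConst ω n = phiConst ω 0 / Real.sqrt (2 ^ n * n.factorial) := by
  rw [phiConst, phiConst, Real.sqrt_mul (by positivity)]
  simp
  ring

theorem half_ofReal_re_pos {ω : ℝ} (hω : 0 < ω) : 0 < ((ω / 2 : ℝ) : ℂ).re := by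
  simpa using hω

theorem phi_eq_toLp {ω : ℝ} (hω : 0 < ω) (n : ℕ) :
    phi hω n = (phiConst ω n : ℂ) •
      ((gaussSchwartz ((ω / 2 : ℝ) : ℂ) (hermiteScaled ω n)).toLp 2 volume : L2) := by
  rw [← toLp_smul_schwartz]
  refine Lp.ext ?_
  filter_upwards [(memLp_phiFun hω n).coeFn_toLp, ((phiConst ω n : ℂ) •
    gaussSchwartz ((ω / 2 : ℝ) : ℂ) (hermiteScaled ω n)).coeFn_toLp 2 volume] with q h1 h2
  have h1' : (phi hω n) q = (phiFun ω n q : ℂ) := h1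
  have e : (hermiteScaled ω n).eval (q : ℂ) = ((hermiteH n).eval (Real.sqrt ω * q) : ℝ) := by
    rw [hermiteScaled, Polynomial.eval_comp, Polynomial.eval_map]
    simp only [Polynomial.eval_mul, Polynomial.eval_C, Polynomial.eval_X]
    rw [← Complex.ofReal_mul]
    exact Polynomial.eval₂_at_apply Complex.ofRealHom _
  rw [h1', h2, smul_apply, coe_gaussSchwartz (half_ofReal_re_pos hω), gaussFun, e, phiFun,
    phiConst]
  push_cast
  rw [smul_eq_mul, show -(ω : ℂ) * (q : ℂ) ^ 2 / 2 = -(ω / 2) * (q : ℂ) ^ 2 by ring]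
  ring

theorem map_conj_hermiteScaled (ω : ℝ) (n : ℕ) :
    (hermiteScaled ω n).map (starRingEnd ℂ) = hermiteScaled ω n := by
  have h : (starRingEnd ℂ).comp Complex.ofRealHom = Complex.ofRealHom := by
    ext x
    exact Complex.conj_ofReal x
  rw [hermiteScaled, Polynomial.map_comp, Polynomial.map_map, h]
  simp

theorem inner_phi_gaussSchwartz {ω : ℝ} (hω : 0 < ω) (n : ℕ) {b : ℂ} (hb : 0 < b.re)
    (p : Polynomial ℂ) :
    ⟪phi hω n, (gaussSchwartz b p).toLp 2 volume⟫_ℂ =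
      phiConst ω n * gaussInt (ω / 2 + b) (hermiteScaled ω n * p) := by
  rw [phi_eq_toLp, inner_smul_left, Complex.conj_ofReal,
    inner_gaussSchwartz (half_ofReal_re_pos hω) hb, map_conj_hermiteScaled, Complex.conj_ofReal]
  push_cast
  rfl

theorem gaussInt_one_ofReal {a : ℝ} (ha : 0 < a) :
    gaussInt a 1 = (Real.sqrt (Real.pi / a) : ℝ) := by
  rw [gaussInt_one (by simpa using ha), Real.sqrt_eq_rpow,
    Complex.ofReal_cpow (by positivity)]
  push_cast
  rfl

theorem orthonormal_phi {ω : ℝ} (hω : 0 < ω) : Orthonormal ℂ (phi hω) := by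
  classical
  rw [orthonormal_iff_ite]
  intro n m
  rw [phi_eq_toLp hω m, inner_smul_right, inner_phi_gaussSchwartz hω n (half_ofReal_re_pos hω)]
  have : (ω / 2 + (ω / 2 : ℝ) : ℂ) = ω := by
    push_cast
    ring
  rw [this, gaussInt_hermiteScaled_mul hω, gaussInt_one_ofReal hω]
  split_ifs with h
  · subst h
    have h1 := phiConst_sq hω n
    have h2 : Real.sqrt (ω / Real.pi) * Real.sqrt (Real.pi / ω) = 1 := by
      rw [← Real.sqrt_mul (by positivity), div_mul_div_cancel₀ Real.pi_ne_zero, div_self hω.ne',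
        Real.sqrt_one]
    have h3 : phiConst ω n * (phiConst ω n * (2 ^ n * n.factorial * Real.sqrt (Real.pi / ω)))
        = 1 := by
      rw [← mul_assoc, ← sq, h1]
      field_simp
      linarith
    exact_mod_cast h3
  · simp

/-! ### The evolved vacuum -/

section Evolution

variable {κ : ℝ → ℝ} {I : Set ℝ} {c s : ℝ → ℝ → ℝ}

/-- The exponent `Z = -iu'/u` of the evolved Gaussian `exp(-Z q²/2)`. -/
noncomputable def gaussExponent (c s : ℝ → ℝ → ℝ) (ω t₀ t : ℝ) : ℂ :=
  -Complex.I * (complexSolDot c s ω t₀ t / complexSol c s ω t₀ t)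

theorem IsFundamentalPair.re_gaussExponent (h : IsFundamentalPair κ I c s) (hI : IsOpen I)
    (hI' : I.OrdConnected) {ω t t₀ : ℝ} (ht : t ∈ I) (ht₀ : t₀ ∈ I) :
    (gaussExponent c s ω t₀ t).re = ω / ‖complexSol c s ω t₀ t‖ ^ 2 := by
  rw [← h.im_complexSolDot_div hI hI' ht ht₀, gaussExponent, Complex.mul_re]
  simp

theorem IsFundamentalPair.re_gaussExponent_pos (h : IsFundamentalPair κ I c s) (hI : IsOpen I)
    (hI' : I.OrdConnected) {ω t t₀ : ℝ} (hω : 0 < ω) (ht : t ∈ I) (ht₀ : t₀ ∈ I) :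
    0 < (gaussExponent c s ω t₀ t).re := by
  have := norm_pos_iff.2 (h.complexSol_ne_zero hI hI' hω ht ht₀)
  rw [h.re_gaussExponent hI hI' ht ht₀]
  positivity

/-- The Riccati form of `u'' = -κu`. -/
theorem IsFundamentalPair.hasDerivAt_gaussExponent (h : IsFundamentalPair κ I c s) (hI : IsOpen I)
    (hI' : I.OrdConnected) {ω t t₀ : ℝ} (hω : 0 < ω) (ht : t ∈ I) (ht₀ : t₀ ∈ I) :
    HasDerivAt (gaussExponent c s ω t₀)
      (Complex.I * (κ t - gaussExponent c s ω t₀ t ^ 2)) t := by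
  have hne := h.complexSol_ne_zero hI hI' hω ht ht₀
  refine HasDerivAt.congr_deriv (((h.hasDerivAt_complexSolDot ω ht ht₀).div
    (h.hasDerivAt_complexSol ω ht ht₀) hne).const_mul (-Complex.I)) ?_
  rw [gaussExponent, mul_pow, neg_sq, Complex.I_sq]
  field_simp
  ring

/-- The evolved vacuum as a Schwartz function. -/
noncomputable def evolvedVacuum (c s : ℝ → ℝ → ℝ) (ω t₀ t : ℝ) : 𝓢(ℝ, ℂ) :=
  (phiConst ω 0 * Complex.exp (-logSol c s ω t₀ t / 2)) •
    gaussSchwartz (gaussExponent c s ω t₀ t / 2) 1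

/-- The Riccati equation matches the `q²` terms; the derivative `-iZ/2` of the exponent `-g/2`
matches the constant term. -/
theorem IsFundamentalPair.hasDerivAt_evolvedVacuum (h : IsFundamentalPair κ I c s) (hI : IsOpen I)
    (hI' : I.OrdConnected) {ω t t₀ : ℝ} (hω : 0 < ω) (ht : t ∈ I) (ht₀ : t₀ ∈ I) :
    HasDerivAt (fun τ => ((evolvedVacuum c s ω t₀ τ).toLp 2 volume : L2))
      (-Complex.I • ((hamiltonian κ t (evolvedVacuum c s ω t₀ t)).toLp 2 volume : L2)) t := by
  have hZ : 0 < (gaussExponent c s ω t₀ t / 2).re := by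
    simpa using h.re_gaussExponent_pos hI hI' hω ht ht₀
  simp only [evolvedVacuum, toLp_smul_schwartz, map_smul, hamiltonian_gaussSchwartz_one κ t hZ,
    toLp_add_schwartz]
  have h1 : HasDerivAt (fun τ => ((gaussSchwartz (gaussExponent c s ω t₀ τ / 2) 1).toLp 2 volume :
      L2)) ((Complex.I * (κ t - gaussExponent c s ω t₀ t ^ 2) / 2) •
      ((gaussSchwartz (gaussExponent c s ω t₀ t / 2) (-Polynomial.X ^ 2)).toLp 2 volume : L2)) t :=
    HasDerivAt.scomp (g₁ := fun b : ℂ => ((gaussSchwartz b 1).toLp 2 volume : L2)) t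
      (hasDerivAt_toLp_gaussSchwartz hZ)
      ((h.hasDerivAt_gaussExponent hI hI' hω ht ht₀).div_const 2)
  have h2 := (((h.hasDerivAt_logSol hI hI' hω ht ht₀).fun_neg.div_const 2).cexp).const_mul
    (phiConst ω 0 : ℂ)
  refine HasDerivAt.congr_deriv (h2.smul h1) ?_
  rw [show (-Polynomial.X ^ 2 : Polynomial ℂ) = (-1 : ℂ) • Polynomial.X ^ 2 by simp,
    gaussSchwartz_smul, toLp_smul_schwartz]
  have e : complexSolDot c s ω t₀ t / complexSol c s ω t₀ t =
      Complex.I * gaussExponent c s ω t₀ t := by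
    rw [gaussExponent, ← mul_assoc]
    simp
  rw [e]
  module

theorem IsFundamentalPair.norm_exp_neg_logSol_half_sq (h : IsFundamentalPair κ I c s)
    (hI : IsOpen I) (hI' : I.OrdConnected) {ω t t₀ : ℝ} (hω : 0 < ω) (ht : t ∈ I) (ht₀ : t₀ ∈ I) :
    ‖Complex.exp (-logSol c s ω t₀ t / 2)‖ ^ 2 = ‖complexSol c s ω t₀ t‖⁻¹ := by
  rw [← norm_pow, ← Complex.exp_nat_mul, ← h.exp_logSol hI hI' hω ht ht₀, ← norm_inv,
    ← Complex.exp_neg]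
  congr 2
  push_cast
  ring

/-- The factor `1/|u|` from the squared prefactor cancels the Gaussian width `√(π / Re Z)`, because
`Re Z = ω/|u|²`. -/
theorem IsFundamentalPair.norm_evolvedVacuum (h : IsFundamentalPair κ I c s) (hI : IsOpen I)
    (hI' : I.OrdConnected) {ω t t₀ : ℝ} (hω : 0 < ω) (ht : t ∈ I) (ht₀ : t₀ ∈ I) :
    ‖((evolvedVacuum c s ω t₀ t).toLp 2 volume : L2)‖ = 1 := by
  have hZ0 := h.re_gaussExponent_pos hI hI' hω ht ht₀
  have hZ : 0 < (gaussExponent c s ω t₀ t / 2).re := by simpa using hZ0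
  have hu := norm_pos_iff.2 (h.complexSol_ne_zero hI hI' hω ht ht₀)
  have e : (starRingEnd ℂ) (gaussExponent c s ω t₀ t / 2) + gaussExponent c s ω t₀ t / 2 =
      ((gaussExponent c s ω t₀ t).re : ℂ) := by
    rw [add_comm, Complex.add_conj]
    simp
    ring
  have h1 := inner_gaussSchwartz hZ hZ 1 1
  rw [e, Polynomial.map_one, one_mul, gaussInt_one_ofReal hZ0, inner_self_eq_norm_sq_to_K] at h1
  have h1' : ‖((gaussSchwartz (gaussExponent c s ω t₀ t / 2) 1).toLp 2 volume : L2)‖ ^ 2 =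
      Real.sqrt (Real.pi / (gaussExponent c s ω t₀ t).re) :=
    Complex.ofReal_injective ((Complex.ofReal_pow _ _).trans h1)
  rw [← sq_eq_sq₀ (norm_nonneg _) zero_le_one, evolvedVacuum, toLp_smul_schwartz, norm_smul,
    mul_pow, h1', norm_mul, mul_pow, h.norm_exp_neg_logSol_half_sq hI hI' hω ht ht₀,
    Complex.norm_real, Real.norm_eq_abs, sq_abs, phiConst_sq hω,
    h.re_gaussExponent hI hI' ht ht₀, div_div_eq_mul_div, mul_comm Real.pi, mul_div_assoc,
    Real.sqrt_mul (by positivity), Real.sqrt_sq hu.le]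
  have h2 : Real.sqrt (ω / Real.pi) * Real.sqrt (Real.pi / ω) = 1 := by
    rw [← Real.sqrt_mul (by positivity), div_mul_div_cancel₀ Real.pi_ne_zero, div_self hω.ne',
      Real.sqrt_one]
  simp only [pow_zero, Nat.factorial_zero, Nat.cast_one, mul_one, div_one, one_pow]
  field_simp
  linarith

theorem IsFundamentalPair.evolvedVacuum_self (h : IsFundamentalPair κ I c s) {ω t₀ : ℝ}
    (hω : 0 < ω) (ht₀ : t₀ ∈ I) :
    ((evolvedVacuum c s ω t₀ t₀).toLp 2 volume : L2) = phi hω 0 := by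
  have e : gaussExponent c s ω t₀ t₀ / 2 = ((ω / 2 : ℝ) : ℂ) := by
    have h1 := h.s_deriv_initial t₀ ht₀
    have h2 := h.c_deriv_initial t₀ ht₀
    simp only [gaussExponent, complexSol, complexSolDot, h.c_initial t₀ ht₀,
      h.s_initial t₀ ht₀, dot, h1, h2]
    push_cast
    linear_combination (-ω / 2 : ℂ) * Complex.I_sq
  rw [evolvedVacuum, e, toLp_smul_schwartz, phi_eq_toLp, hermiteScaled_zero]
  simp [logSol]

theorem IsEvolution.apply_phi_zero {U : ℝ → ℝ → (L2 ≃ₗᵢ[ℂ] L2)} (hU : IsEvolution κ I U)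
    (h : IsFundamentalPair κ I c s) (hI : IsOpen I) (hI' : I.OrdConnected) {ω t t₀ : ℝ}
    (hω : 0 < ω) (ht : t ∈ I) (ht₀ : t₀ ∈ I) :
    U t t₀ (phi hω 0) = (evolvedVacuum c s ω t₀ t).toLp 2 volume := by
  rw [← h.evolvedVacuum_self hω ht₀]
  exact hU.apply_eq_of_strong_solution hI hI'
    (fun τ hτ => h.hasDerivAt_evolvedVacuum hI hI' hω hτ ht₀)
    (fun τ hτ => h.norm_evolvedVacuum hI hI' hω hτ ht₀) ht ht₀

end Evolution

/-! ### The index of the zeros and the branch of the square root -/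

section Index

variable {κ : ℝ → ℝ} {I : Set ℝ} {c s : ℝ → ℝ → ℝ}

/-- The phase of `u` has velocity `ω/|u|² > 0`, so it meets each multiple of `π` at most once. -/
theorem IsFundamentalPair.strictMonoOn_im_logSol (h : IsFundamentalPair κ I c s) (hI : IsOpen I)
    (hI' : I.OrdConnected) {ω t₀ : ℝ} (hω : 0 < ω) (ht₀ : t₀ ∈ I) :
    StrictMonoOn (fun τ => (logSol c s ω t₀ τ).im) I := by
  have hd : ∀ x ∈ I, HasDerivAt (fun τ => (logSol c s ω t₀ τ).im)
      (ω / ‖complexSol c s ω t₀ x‖ ^ 2) x := fun x hx => by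
    rw [← h.im_complexSolDot_div hI hI' hx ht₀]
    exact Complex.imCLM.hasFDerivAt.comp_hasDerivAt x (h.hasDerivAt_logSol hI hI' hω hx ht₀)
  refine strictMonoOn_of_deriv_pos hI'.convex
    (fun x hx => (hd x hx).continuousAt.continuousWithinAt) fun x hx => ?_
  rw [hI.interior_eq] at hx
  have := norm_pos_iff.2 (h.complexSol_ne_zero hI hI' hω hx ht₀)
  rw [(hd x hx).deriv]
  positivity

theorem IsFundamentalPair.mul_s_eq (h : IsFundamentalPair κ I c s) (hI : IsOpen I)
    (hI' : I.OrdConnected) {ω t t₀ : ℝ} (hω : 0 < ω) (ht : t ∈ I) (ht₀ : t₀ ∈ I) :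
    ω * s t t₀ = (Complex.exp (logSol c s ω t₀ t)).im := by
  rw [h.exp_logSol hI hI' hω ht ht₀]
  simp [complexSol]

theorem IsFundamentalPair.s_eq_zero_iff (h : IsFundamentalPair κ I c s) (hI : IsOpen I)
    (hI' : I.OrdConnected) {ω t t₀ : ℝ} (hω : 0 < ω) (ht : t ∈ I) (ht₀ : t₀ ∈ I) :
    s t t₀ = 0 ↔ ∃ n : ℤ, (n : ℝ) * Real.pi = (logSol c s ω t₀ t).im := by
  have h1 := h.mul_s_eq hI hI' hω ht ht₀
  rw [Complex.exp_im] at h1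
  rw [← Real.sin_eq_zero_iff]
  constructor
  · intro h0
    rw [h0, mul_zero] at h1
    exact (mul_eq_zero.1 h1.symm).resolve_left (Real.exp_pos _).ne'
  · intro h0
    rw [h0, mul_zero] at h1
    exact (mul_eq_zero.1 h1).resolve_left hω.ne'

/-- Sending a zero to its phase divided by `π` is a bijection onto the integers between the two
floors: injective by monotonicity, surjective by the intermediate value theorem. -/
theorem IsFundamentalPair.ncard_zeros (h : IsFundamentalPair κ I c s) (hI : IsOpen I)
    (hI' : I.OrdConnected) {ω t₀ a b : ℝ} (hω : 0 < ω) (ht₀ : t₀ ∈ I) (ha : a ∈ I) (hb : b ∈ I)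
    (hab : a ≤ b) :
    ({τ ∈ Ioc a b | s τ t₀ = 0}.ncard : ℤ) =
      ⌊(logSol c s ω t₀ b).im / Real.pi⌋ - ⌊(logSol c s ω t₀ a).im / Real.pi⌋ := by
  set θ : ℝ → ℝ := fun τ => (logSol c s ω t₀ τ).im
  have hmono : StrictMonoOn θ I := h.strictMonoOn_im_logSol hI hI' hω ht₀
  have hsub : Icc a b ⊆ I := hI'.out ha hb
  have hfl : ∀ {τ : ℝ} {n : ℤ}, (n : ℝ) * Real.pi = θ τ → ⌊θ τ / Real.pi⌋ = n := by
    intro τ n hn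
    rw [← hn, mul_div_cancel_right₀ _ Real.pi_ne_zero, Int.floor_intCast]
  have hinj : InjOn (fun τ => ⌊θ τ / Real.pi⌋) {τ ∈ Ioc a b | s τ t₀ = 0} := by
    rintro x ⟨hx, hx0⟩ y ⟨hy, hy0⟩ hxy
    have hxI := hsub ⟨hx.1.le, hx.2⟩
    have hyI := hsub ⟨hy.1.le, hy.2⟩
    obtain ⟨n, hn⟩ := (h.s_eq_zero_iff hI hI' hω hxI ht₀).1 hx0
    obtain ⟨k, hk⟩ := (h.s_eq_zero_iff hI hI' hω hyI ht₀).1 hy0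
    refine hmono.injOn hxI hyI ?_
    simp only [hfl hn, hfl hk] at hxy
    change (logSol c s ω t₀ x).im = (logSol c s ω t₀ y).im
    rw [← hn, ← hk, hxy]
  have himg : (fun τ => ⌊θ τ / Real.pi⌋) '' {τ ∈ Ioc a b | s τ t₀ = 0} =
      (Finset.Ioc ⌊θ a / Real.pi⌋ ⌊θ b / Real.pi⌋ : Finset ℤ) := by
    ext n
    -- For an integer `n`, `⌊x⌋ < n` means `x < n`, and `n ≤ ⌊y⌋` means `n ≤ y`; thus `Ioc` of the
    -- floors corresponds exactly to `Ioc` of the times.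
    rw [Finset.coe_Ioc, mem_Ioc, Int.floor_lt, Int.le_floor, div_lt_iff₀ Real.pi_pos,
      le_div_iff₀ Real.pi_pos]
    constructor
    · rintro ⟨x, ⟨hx, hx0⟩, hxn⟩
      have hxI := hsub ⟨hx.1.le, hx.2⟩
      obtain ⟨k, hk⟩ := (h.s_eq_zero_iff hI hI' hω hxI ht₀).1 hx0
      have : k = n := by rw [← hxn]; exact (hfl hk).symm
      subst this
      rw [hk]
      exact ⟨hmono ha hxI hx.1, hmono.monotoneOn hxI hb hx.2⟩
    · rintro ⟨h1, h2⟩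
      have hcont : ContinuousOn θ (Icc a b) := fun x hx =>
        (Complex.continuous_im.continuousAt.comp
          (h.hasDerivAt_logSol hI hI' hω (hsub hx) ht₀).continuousAt).continuousWithinAt
      obtain ⟨x, hx, hxn⟩ := intermediate_value_Icc hab hcont ⟨h1.le, h2⟩
      have hax : a ≠ x := by
        rintro rfl
        exact h1.ne hxn
      exact ⟨x, ⟨⟨lt_of_le_of_ne hx.1 hax, hx.2⟩,
        (h.s_eq_zero_iff hI hI' hω (hsub hx) ht₀).2 ⟨n, hxn.symm⟩⟩, hfl hxn.symm⟩
  rw [← hinj.ncard_image, himg, ncard_coe_finset, Int.card_Ioc, Int.toNat_of_nonneg]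
  refine sub_nonneg.2 (Int.floor_mono ?_)
  exact div_le_div_of_nonneg_right (hmono.monotoneOn ha hb hab) Real.pi_pos.le

/-- The index is determined by the continuous argument of `c + iωs`. -/
theorem IsFundamentalPair.zeroIndex_eq_floor (h : IsFundamentalPair κ I c s) (hI : IsOpen I)
    (hI' : I.OrdConnected) {ω t t₀ : ℝ} (hω : 0 < ω) (ht : t ∈ I) (ht₀ : t₀ ∈ I) :
    zeroIndex (fun τ => s τ t₀) t t₀ = ⌊(logSol c s ω t₀ t).im / Real.pi⌋ := by
  have h0 : logSol c s ω t₀ t₀ = 0 := by simp [logSol]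
  rw [zeroIndex]
  rcases le_total t₀ t with hle | hle
  · rw [h.ncard_zeros hI hI' hω ht₀ ht₀ ht hle, Ioc_eq_empty (not_lt.2 hle)]
    simp [h0]
  · rw [h.ncard_zeros hI hI' hω ht₀ ht ht₀ hle, Ioc_eq_empty (not_lt.2 hle)]
    simp [h0]

end Index

/-- The criterion for recognizing the principal root: exhibit a square root in the open right
half-plane. -/
theorem cpow_half_eq_of_sq_eq {x y : ℂ} (hx : 0 < x.re) (h : x ^ 2 = y) :
    y ^ (1 / 2 : ℂ) = x := by
  rw [← h, one_div, Complex.sq_cpow_two_inv hx]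

/-- The phase is `φ - arg w / 2` with `|arg w / 2| < π/4` strictly, so it stays inside `(-π/2, π/2)`
even when `|φ| = π/4`. -/
theorem re_ofReal_mul_exp_sub_log_half_pos {r φ : ℝ} {w : ℂ} (hr : 0 < r) (hw : 0 < w.re)
    (hφ : |φ| ≤ Real.pi / 4) :
    0 < ((r : ℂ) * Complex.exp (Complex.I * φ - Complex.log w / 2)).re := by
  have harg := abs_lt.1 (Complex.abs_arg_lt_pi_div_two_iff.2 (Or.inl hw))
  have hφ' := abs_le.1 hφ
  rw [Complex.re_ofReal_mul, Complex.exp_re]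
  have him : (Complex.I * φ - Complex.log w / 2).im = φ - w.arg / 2 := by
    simp [Complex.log_im]
  rw [him]
  have := Real.cos_pos_of_mem_Ioo (x := φ - w.arg / 2) ⟨by linarith, by linarith⟩
  positivity

theorem exp_log_half_sq {w : ℂ} (hw : w ≠ 0) : Complex.exp (-Complex.log w / 2) ^ 2 = w⁻¹ := by
  rw [← Complex.exp_nat_mul]
  push_cast
  rw [mul_div_cancel₀ _ (two_ne_zero), Complex.exp_neg, Complex.exp_log hw]

theorem two_pi_div_cpow_half {w : ℂ} (hw : 0 < w.re) :
    (Real.pi / (w / 2)) ^ (1 / 2 : ℂ) =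
      Real.sqrt (2 * Real.pi) * Complex.exp (-Complex.log w / 2) := by
  have hw0 : w ≠ 0 := fun h => by simp [h] at hw
  refine cpow_half_eq_of_sq_eq ?_ ?_
  · simpa [neg_div] using re_ofReal_mul_exp_sub_log_half_pos (φ := 0)
      (Real.sqrt_pos.2 Real.two_pi_pos) hw (by rw [abs_zero]; positivity)
  · rw [mul_pow, exp_log_half_sq hw0, ← Complex.ofReal_pow, Real.sq_sqrt Real.two_pi_pos.le]
    push_cast
    field_simp

/-- The branch of the square root in the vacuum amplitude. -/
theorem vacuum_branch {g w : ℂ} {s ω : ℝ} (hω : 0 < ω) (hw : 0 < w.re)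
    (hs : ω * s = (Complex.exp g).im) (hs0 : s ≠ 0) :
    (2 * Complex.I * ω * s / (Complex.exp g * w)) ^ (1 / 2 : ℂ) *
      Complex.exp (-(Complex.I * Real.pi / 4)) *
      (Complex.exp (Complex.I * ((-1 / 2 : ℝ) : ℂ) * Real.pi * ((⌊g.im / Real.pi⌋ : ℤ) : ℂ)) *
        ((|s| ^ (-1 / 2 : ℝ) : ℝ) : ℂ)) =
      Real.sqrt (2 * ω) * Complex.exp (-g / 2) * Complex.exp (-Complex.log w / 2) := by
  have hw0 : w ≠ 0 := fun h => by simp [h] at hw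
  set m : ℤ := ⌊g.im / Real.pi⌋
  -- `α` is the phase modulo `π`. It lies in `(0, π)` because `s ≠ 0`, and `(-1)^m` carries the sign
  -- of `s`.
  set α : ℝ := g.im - m * Real.pi with hα
  have hα0 : 0 ≤ α := by
    have := Int.floor_le (g.im / Real.pi)
    rw [le_div_iff₀ Real.pi_pos] at this
    linarith
  have hα1 : α < Real.pi := by
    have := Int.lt_floor_add_one (g.im / Real.pi)
    rw [div_lt_iff₀ Real.pi_pos] at this
    linarith
  have hθ : g.im = α + m * Real.pi := by rw [hα]; ring
  have hsin : Real.sin g.im = (-1) ^ m * Real.sin α := by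
    rw [hθ, Real.sin_add_int_mul_pi]
  have hs1 : ω * s = Real.exp g.re * ((-1) ^ m * Real.sin α) := by
    rw [hs, Complex.exp_im, hsin]
  have hsinα : 0 < Real.sin α := by
    refine Real.sin_pos_of_pos_of_lt_pi (lt_of_le_of_ne hα0 fun h => ?_) hα1
    rw [← h, Real.sin_zero, mul_zero, mul_zero] at hs1
    exact (mul_ne_zero hω.ne' hs0) hs1
  have hsgn : ((-1 : ℝ) ^ m) * (-1) ^ m = 1 := by
    rw [← mul_zpow]
    simp
  have habs : |s| = Real.exp g.re * Real.sin α / ω := by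
    have h := congrArg abs hs1
    rw [abs_mul, abs_of_pos hω, abs_mul, abs_mul, abs_zpow, abs_neg, abs_one, one_zpow, one_mul,
      abs_of_pos (Real.exp_pos _), abs_of_pos hsinα] at h
    rw [eq_div_iff hω.ne', mul_comm, h]
  have hexpm : Complex.exp (m * (Real.pi * Complex.I)) = ((-1 : ℝ) ^ m : ℝ) := by
    rw [Complex.exp_int_mul, Complex.exp_pi_mul_I]
    push_cast
    rfl
  have hg : g = g.re + α * Complex.I + m * (Real.pi * Complex.I) := by
    apply Complex.ext
    · simp
    · simp [hθ]
  have hexpg : Complex.exp g = Complex.exp g.re * Complex.exp (α * Complex.I) *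
      ((-1 : ℝ) ^ m : ℝ) := by
    conv_lhs => rw [hg, Complex.exp_add, Complex.exp_add, hexpm]
  -- The candidate principal root. The signs `(-1)^m` and moduli of `s` and `exp g` cancel, leaving
  -- `2 sin α · i exp(-iα) / w`; halving the phase `π/2 - α` gives an angle within `π/4` of zero.
  set X : ℂ := (Real.sqrt (2 * Real.sin α) : ℂ) *
    Complex.exp (Complex.I * ((Real.pi / 4 - α / 2 : ℝ) : ℂ) - Complex.log w / 2) with hX
  have hXre : 0 < X.re := re_ofReal_mul_exp_sub_log_half_pos (Real.sqrt_pos.2 (by positivity)) hw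
    (abs_le.2 ⟨by linarith, by linarith⟩)
  have hXsq : X ^ 2 = 2 * Complex.I * ω * s / (Complex.exp g * w) := by
    have e1 : Complex.exp (Complex.I * ((Real.pi / 4 - α / 2 : ℝ) : ℂ) - Complex.log w / 2) ^ 2 =
        Complex.I * (Complex.exp (α * Complex.I))⁻¹ * w⁻¹ := by
      trans Complex.exp (Real.pi / 2 * Complex.I) * Complex.exp (-(α * Complex.I)) *
        Complex.exp (-Complex.log w)
      · rw [← Complex.exp_nat_mul, ← Complex.exp_add, ← Complex.exp_add]
        congr 1
        push_cast
        ring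
      · rw [Complex.exp_pi_div_two_mul_I, Complex.exp_neg, Complex.exp_neg, Complex.exp_log hw0]
    have e2 : (ω : ℂ) * s = Complex.exp g.re * (((-1 : ℝ) ^ m : ℝ) * Real.sin α) := by
      exact_mod_cast congrArg Complex.ofReal hs1
    have e3 : (((-1 : ℝ) ^ m : ℝ) : ℂ) ≠ 0 := by
      exact_mod_cast left_ne_zero_of_mul_eq_one hsgn
    rw [hX, mul_pow, e1, ← Complex.ofReal_pow, Real.sq_sqrt (by positivity), mul_assoc (2 * _),
      e2, hexpg]
    have := Complex.exp_ne_zero g.re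
    have := Complex.exp_ne_zero (α * Complex.I)
    push_cast at e3 ⊢
    field_simp
  rw [cpow_half_eq_of_sq_eq hXre hXsq, habs]
  -- Moduli are compared here and phases in `hfin`: `exp(-iπ/4)` removes the offset `π/4`, and
  -- `exp(-iπm/2)` completes `α` to `Im g`.
  have hpow : (Real.exp g.re * Real.sin α / ω) ^ (-1 / 2 : ℝ) * Real.sqrt (2 * Real.sin α) =
      Real.sqrt (2 * ω) * Real.exp (-g.re / 2) := by
    have e : (Real.exp g.re * Real.sin α / ω) ^ (-1 / 2 : ℝ) =
        (Real.exp (g.re / 2) * (Real.sqrt (Real.sin α) / Real.sqrt ω))⁻¹ := by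
      rw [neg_div, Real.rpow_neg (by positivity), ← Real.sqrt_eq_rpow, mul_div_assoc,
        Real.sqrt_mul (Real.exp_pos _).le, Real.sqrt_div hsinα.le, Real.exp_half]
    rw [e, neg_div, Real.exp_neg, Real.sqrt_mul zero_le_two, Real.sqrt_mul zero_le_two]
    have := Real.sqrt_pos.2 hsinα
    have := Real.sqrt_pos.2 hω
    have := Real.exp_pos (g.re / 2)
    field_simp
  have hpow' := congrArg Complex.ofReal hpow
  rw [Complex.ofReal_mul, Complex.ofReal_mul, Complex.ofReal_exp] at hpow'
  have hfin : Complex.exp (Complex.I * ((Real.pi / 4 - α / 2 : ℝ) : ℂ) - Complex.log w / 2) *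
      Complex.exp (-(Complex.I * Real.pi / 4)) *
      Complex.exp (Complex.I * ((-1 / 2 : ℝ) : ℂ) * Real.pi * (m : ℂ)) *
      Complex.exp ((-g.re / 2 : ℝ) : ℂ) =
      Complex.exp (-g / 2) * Complex.exp (-Complex.log w / 2) := by
    simp only [← Complex.exp_add]
    congr 1
    conv_rhs => rw [hg]
    push_cast
    ring
  rw [hX]
  linear_combination Complex.exp (Complex.I * ((Real.pi / 4 - α / 2 : ℝ) : ℂ) -
    Complex.log w / 2) * Complex.exp (-(Complex.I * Real.pi / 4)) *
      Complex.exp (Complex.I * ((-1 / 2 : ℝ) : ℂ) * Real.pi * (m : ℂ)) * hpow' +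
    (Real.sqrt (2 * ω) : ℂ) * hfin

/-! ### The central binomial series and Parseval's identity -/

theorem ascPochhammer_eval_half (n : ℕ) :
    (ascPochhammer ℝ n).eval (1 / 2) = (2 * n).factorial / (4 ^ n * n.factorial) := by
  induction n with
  | zero => simp
  | succ n ih =>
    rw [ascPochhammer_succ_eval, ih, show 2 * (n + 1) = 2 * n + 2 by ring, Nat.factorial_succ,
      Nat.factorial_succ, Nat.factorial_succ]
    push_cast
    field_simp
    ring

/-- The binomial series of `(1 - x)^{-1/2}`, whose coefficients are `(1/2)(3/2)⋯(n - 1/2) / n!`. -/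
theorem hasSum_centralBinom {x : ℝ} (hx : |x| < 1) :
    HasSum (fun n : ℕ => ((2 * n).factorial / (4 ^ n * n.factorial ^ 2) : ℝ) * x ^ n)
      (Real.sqrt (1 - x))⁻¹ := by
  have h := (Real.one_div_one_sub_rpow_hasFPowerSeriesOnBall_zero (1 / 2)).hasSum (y := x)
    (by simpa [enorm_eq_nnnorm, ← NNReal.coe_lt_coe] using hx)
  rw [zero_add, ← Real.sqrt_eq_rpow, one_div (Real.sqrt _)] at h
  refine h.congr_fun fun n => ?_
  rw [FormalMultilinearSeries.ofScalars_apply_eq, smul_eq_mul]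
  congr 1
  have h1 := Ring.factorial_nsmul_multichoose_eq_ascPochhammer (1 / 2 : ℝ) n
  rw [Polynomial.ascPochhammer_smeval_eq_eval, ascPochhammer_eval_half, nsmul_eq_mul] at h1
  have h2 : Ring.choose (1 / 2 + (n : ℝ) - 1) n = Ring.multichoose (1 / 2 : ℝ) n := by
    rw [Ring.choose]
    congr 1
    ring
  rw [h2]
  have : (n.factorial : ℝ) ≠ 0 := by exact_mod_cast n.factorial_ne_zero
  field_simp at h1 ⊢
  linarith

/-- The squared distance of `x` from a partial sum is the defect in Bessel's inequality. Parseval's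
identity for this one vector suffices; the family need not be complete. -/
theorem hasSum_of_hasSum_norm_sq {ι E : Type*} [NormedAddCommGroup E] [InnerProductSpace ℂ E]
    {e : ι → E} (he : Orthonormal ℂ e) {x : E}
    (h : HasSum (fun i => ‖⟪e i, x⟫_ℂ‖ ^ 2) (‖x‖ ^ 2)) :
    HasSum (fun i => ⟪e i, x⟫_ℂ • e i) x := by
  have key : ∀ t : Finset ι, ‖x - ∑ i ∈ t, ⟪e i, x⟫_ℂ • e i‖ ^ 2 =
      ‖x‖ ^ 2 - ∑ i ∈ t, ‖⟪e i, x⟫_ℂ‖ ^ 2 := by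
    intro t
    have h1 : ⟪∑ i ∈ t, ⟪e i, x⟫_ℂ • e i, x⟫_ℂ = ((∑ i ∈ t, ‖⟪e i, x⟫_ℂ‖ ^ 2 : ℝ) : ℂ) := by
      rw [sum_inner]
      push_cast
      refine Finset.sum_congr rfl fun i _ => ?_
      rw [inner_smul_left]
      exact RCLike.conj_mul _
    have h2 : ⟪∑ i ∈ t, ⟪e i, x⟫_ℂ • e i, ∑ i ∈ t, ⟪e i, x⟫_ℂ • e i⟫_ℂ =
        ((∑ i ∈ t, ‖⟪e i, x⟫_ℂ‖ ^ 2 : ℝ) : ℂ) := by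
      rw [he.inner_sum]
      push_cast
      exact Finset.sum_congr rfl fun i _ => RCLike.conj_mul _
    have h3 : ‖∑ i ∈ t, ⟪e i, x⟫_ℂ • e i‖ ^ 2 = ∑ i ∈ t, ‖⟪e i, x⟫_ℂ‖ ^ 2 := by
      rw [← inner_self_eq_norm_sq (𝕜 := ℂ), h2]
      exact Complex.ofReal_re _
    rw [norm_sub_sq (𝕜 := ℂ), h3, ← inner_conj_symm, h1]
    simp only [Complex.conj_ofReal, RCLike.re_to_complex, Complex.ofReal_re]
    ring
  have h0 : Tendsto (fun t : Finset ι => ‖x - ∑ i ∈ t, ⟪e i, x⟫_ℂ • e i‖ ^ 2) atTop (𝓝 0) := by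
    have h' : Tendsto (fun t : Finset ι => ∑ i ∈ t, ‖⟪e i, x⟫_ℂ‖ ^ 2) atTop (𝓝 (‖x‖ ^ 2)) := h
    simp only [key]
    exact sub_self (‖x‖ ^ 2) ▸ tendsto_const_nhds.sub h'
  have h1 := (Real.continuous_sqrt.tendsto 0).comp h0
  rw [HasSum, SummationFilter.unconditional_filter, tendsto_iff_norm_sub_tendsto_zero]
  simpa [Function.comp_def, Real.sqrt_sq, norm_sub_rev] using h1

/-! ### The Bogoliubov coefficients and the matrix `Λ` -/

section Amplitudes

variable {κ : ℝ → ℝ} {I : Set ℝ} {c s : ℝ → ℝ → ℝ}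

/-- After exchanging the times, `2ωA = ωu - iu'`; likewise `-2ωB = ωu + iu'` in the next lemma. -/
theorem IsFundamentalPair.mul_bogoliubovA (h : IsFundamentalPair κ I c s) (hI : IsOpen I)
    (hI' : I.OrdConnected) {ω t t₀ : ℝ} (hω : 0 < ω) (ht : t ∈ I) (ht₀ : t₀ ∈ I) :
    2 * ω * bogoliubovA c s ω t₀ t =
      (ω + gaussExponent c s ω t₀ t) * complexSol c s ω t₀ t := by
  have hu := h.complexSol_ne_zero hI hI' hω ht ht₀
  have hω0 : (ω : ℂ) ≠ 0 := by exact_mod_cast hω.ne'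
  rw [gaussExponent, add_mul, mul_assoc (-Complex.I), div_mul_cancel₀ _ hu, bogoliubovA,
    h.c_swap hI hI' ht ht₀, h.s_swap hI hI' ht ht₀, h.dot_c_swap hI hI' ht ht₀,
    h.dot_s_swap hI hI' ht ht₀, complexSol, complexSolDot]
  push_cast
  field_simp
  linear_combination ((ω : ℂ) * dot s t t₀) * Complex.I_sq

theorem IsFundamentalPair.mul_bogoliubovB (h : IsFundamentalPair κ I c s) (hI : IsOpen I)
    (hI' : I.OrdConnected) {ω t t₀ : ℝ} (hω : 0 < ω) (ht : t ∈ I) (ht₀ : t₀ ∈ I) :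
    2 * ω * -bogoliubovB c s ω t₀ t =
      (ω - gaussExponent c s ω t₀ t) * complexSol c s ω t₀ t := by
  have hu := h.complexSol_ne_zero hI hI' hω ht ht₀
  have hω0 : (ω : ℂ) ≠ 0 := by exact_mod_cast hω.ne'
  rw [gaussExponent, sub_mul, mul_assoc (-Complex.I), div_mul_cancel₀ _ hu, bogoliubovB,
    h.c_swap hI hI' ht ht₀, h.s_swap hI hI' ht ht₀, h.dot_c_swap hI hI' ht ht₀,
    h.dot_s_swap hI hI' ht ht₀, complexSol, complexSolDot]
  push_cast
  field_simp
  linear_combination (-(ω : ℂ) * dot s t t₀) * Complex.I_sq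

theorem IsFundamentalPair.re_add_gaussExponent_pos (h : IsFundamentalPair κ I c s) (hI : IsOpen I)
    (hI' : I.OrdConnected) {ω t t₀ : ℝ} (hω : 0 < ω) (ht : t ∈ I) (ht₀ : t₀ ∈ I) :
    0 < ((ω : ℂ) + gaussExponent c s ω t₀ t).re := by
  rw [Complex.add_re, Complex.ofReal_re]
  exact add_pos hω (h.re_gaussExponent_pos hI hI' hω ht ht₀)

theorem IsFundamentalPair.bogoliubovA_ne_zero (h : IsFundamentalPair κ I c s) (hI : IsOpen I)
    (hI' : I.OrdConnected) {ω t t₀ : ℝ} (hω : 0 < ω) (ht : t ∈ I) (ht₀ : t₀ ∈ I) :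
    bogoliubovA c s ω t₀ t ≠ 0 := by
  intro h0
  have h1 := h.mul_bogoliubovA hI hI' hω ht ht₀
  rw [h0, mul_zero] at h1
  refine mul_ne_zero ?_ (h.complexSol_ne_zero hI hI' hω ht ht₀) h1.symm
  intro h2
  have := h.re_add_gaussExponent_pos hI hI' hω ht ht₀
  simp [h2] at this

theorem IsFundamentalPair.neg_B_div_A (h : IsFundamentalPair κ I c s) (hI : IsOpen I)
    (hI' : I.OrdConnected) {ω t t₀ : ℝ} (hω : 0 < ω) (ht : t ∈ I) (ht₀ : t₀ ∈ I) :
    -bogoliubovB c s ω t₀ t / bogoliubovA c s ω t₀ t =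
      ω / ((ω + gaussExponent c s ω t₀ t) / 2) - 1 := by
  have hω0 : (ω : ℂ) ≠ 0 := by exact_mod_cast hω.ne'
  have hu := h.complexSol_ne_zero hI hI' hω ht ht₀
  have hw : (ω : ℂ) + gaussExponent c s ω t₀ t ≠ 0 := fun h2 => by
    have := h.re_add_gaussExponent_pos hI hI' hω ht ht₀
    simp [h2] at this
  rw [← mul_div_mul_left _ _ (mul_ne_zero two_ne_zero hω0), h.mul_bogoliubovA hI hI' hω ht ht₀,
    h.mul_bogoliubovB hI hI' hω ht ht₀]
  field_simp
  ring

/-- The left side expands to the Wronskian. It yields `1 - |B/A|² = |A|⁻²`, the value needed in the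
binomial series. -/
theorem IsFundamentalPair.norm_bogoliubov_sq (h : IsFundamentalPair κ I c s) (hI : IsOpen I)
    (hI' : I.OrdConnected) {ω t t₀ : ℝ} (hω : 0 < ω) (ht : t ∈ I) (ht₀ : t₀ ∈ I) :
    ‖bogoliubovA c s ω t₀ t‖ ^ 2 - ‖bogoliubovB c s ω t₀ t‖ ^ 2 = 1 := by
  have hW := h.wronskian_eq_one hI hI' ht₀ ht
  rw [← Complex.normSq_eq_norm_sq, ← Complex.normSq_eq_norm_sq, Complex.normSq_apply,
    Complex.normSq_apply, bogoliubovA, bogoliubovB]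
  simp
  field_simp
  linear_combination 4 * ω ^ 2 * hW

theorem det_Lam {ω t t₀ : ℝ} (hs : s t t₀ ≠ 0) :
    (Lam c s t₀ t ω ω).det = ((1 + ω ^ 2 * s t t₀ ^ 2 - c t t₀ * c t₀ t : ℂ)
        - Complex.I * ω * s t t₀ * (c t t₀ + c t₀ t)) / s t t₀ ^ 2 := by
  have hs0 : (s t t₀ : ℂ) ≠ 0 := by exact_mod_cast hs
  rw [Lam, Matrix.det_fin_two_of]
  push_cast
  field_simp
  linear_combination ((c t t₀ : ℂ) * c t₀ t - 1) * Complex.I_sq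

/-- The Wronskian turns `1 - c ṡ` into `-ċ s`, so a factor `s` splits off and nonvanishing reduces
to `A ≠ 0`. -/
theorem IsFundamentalPair.det_Lam_numerator (h : IsFundamentalPair κ I c s) (hI : IsOpen I)
    (hI' : I.OrdConnected) {ω t t₀ : ℝ} (hω : 0 < ω) (ht : t ∈ I) (ht₀ : t₀ ∈ I) :
    (1 + ω ^ 2 * s t t₀ ^ 2 - c t t₀ * c t₀ t : ℂ)
        - Complex.I * ω * s t t₀ * (c t t₀ + c t₀ t) =
      -2 * Complex.I * ω * s t t₀ * bogoliubovA c s ω t₀ t := by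
  have hω0 : (ω : ℂ) ≠ 0 := by exact_mod_cast hω.ne'
  have hW : (c t t₀ * dot s t t₀ - dot c t t₀ * s t t₀ : ℂ) = 1 := by
    exact_mod_cast congrArg Complex.ofReal (h.wronskian_eq_one hI hI' ht ht₀)
  rw [bogoliubovA, h.c_swap hI hI' ht ht₀, h.s_swap hI hI' ht ht₀, h.dot_c_swap hI hI' ht ht₀,
    h.dot_s_swap hI hI' ht ht₀]
  push_cast
  field_simp
  linear_combination -hW + (ω ^ 2 * s t t₀ ^ 2 - s t t₀ * dot c t t₀ : ℂ) * Complex.I_sq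

theorem IsFundamentalPair.det_Lam_eq (h : IsFundamentalPair κ I c s) (hI : IsOpen I)
    (hI' : I.OrdConnected) {ω t t₀ : ℝ} (hω : 0 < ω) (ht : t ∈ I) (ht₀ : t₀ ∈ I)
    (hs : s t t₀ ≠ 0) :
    (Lam c s t₀ t ω ω).det = -2 * Complex.I * ω * bogoliubovA c s ω t₀ t / s t t₀ := by
  have hs0 : (s t t₀ : ℂ) ≠ 0 := by exact_mod_cast hs
  rw [det_Lam hs, h.det_Lam_numerator hI hI' hω ht ht₀]
  field_simp

theorem IsFundamentalPair.det_Lam_numerator_ne_zero (h : IsFundamentalPair κ I c s)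
    (hI : IsOpen I) (hI' : I.OrdConnected) {ω t t₀ : ℝ} (hω : 0 < ω) (ht : t ∈ I) (ht₀ : t₀ ∈ I)
    (hs : s t t₀ ≠ 0) :
    (1 + ω ^ 2 * s t t₀ ^ 2 - c t t₀ * c t₀ t : ℂ)
        - Complex.I * ω * s t t₀ * (c t t₀ + c t₀ t) ≠ 0 := by
  have hs0 : (s t t₀ : ℂ) ≠ 0 := by exact_mod_cast hs
  have hω0 : (ω : ℂ) ≠ 0 := by exact_mod_cast hω.ne'
  rw [h.det_Lam_numerator hI hI' hω ht ht₀]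
  exact mul_ne_zero (mul_ne_zero (mul_ne_zero (mul_ne_zero (neg_ne_zero.2 two_ne_zero)
    Complex.I_ne_zero) hω0) hs0) (h.bogoliubovA_ne_zero hI hI' hω ht ht₀)

theorem IsFundamentalPair.det_Lam_ne_zero (h : IsFundamentalPair κ I c s) (hI : IsOpen I)
    (hI' : I.OrdConnected) {ω t t₀ : ℝ} (hω : 0 < ω) (ht : t ∈ I) (ht₀ : t₀ ∈ I)
    (hs : s t t₀ ≠ 0) : (Lam c s t₀ t ω ω).det ≠ 0 := by
  have hs0 : (s t t₀ : ℂ) ≠ 0 := by exact_mod_cast hs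
  rw [det_Lam hs]
  exact div_ne_zero (h.det_Lam_numerator_ne_zero hI hI' hω ht ht₀ hs) (pow_ne_zero 2 hs0)

theorem IsFundamentalPair.inv_Lam_apply (h : IsFundamentalPair κ I c s) (hI : IsOpen I)
    (hI' : I.OrdConnected) {ω t t₀ : ℝ} (hω : 0 < ω) (ht : t ∈ I) (ht₀ : t₀ ∈ I)
    (hs : s t t₀ ≠ 0) :
    (Lam c s t₀ t ω ω)⁻¹ 1 1 = (ω * s t t₀ ^ 2 - Complex.I * s t t₀ * c t t₀ : ℂ) /
      ((1 + ω ^ 2 * s t t₀ ^ 2 - c t t₀ * c t₀ t : ℂ)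
        - Complex.I * ω * s t t₀ * (c t t₀ + c t₀ t)) := by
  have hs0 : (s t t₀ : ℂ) ≠ 0 := by exact_mod_cast hs
  have hne := h.det_Lam_numerator_ne_zero hI hI' hω ht ht₀ hs
  rw [Matrix.inv_def, Ring.inverse_eq_inv', det_Lam hs, Lam,
    Matrix.adjugate_fin_two_of]
  simp only [Matrix.smul_apply, Matrix.of_apply, Matrix.cons_val_one, Matrix.cons_val_zero,
    smul_eq_mul, inv_div]
  push_cast
  rw [div_mul_eq_mul_div]
  congr 1
  field_simp

/-- Both sides plus 1 equal `u/A`, because `A - B = u`. -/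
theorem IsFundamentalPair.two_mul_inv_Lam_sub_one (h : IsFundamentalPair κ I c s) (hI : IsOpen I)
    (hI' : I.OrdConnected) {ω t t₀ : ℝ} (hω : 0 < ω) (ht : t ∈ I) (ht₀ : t₀ ∈ I)
    (hs : s t t₀ ≠ 0) :
    2 * (ω : ℂ) * (Lam c s t₀ t ω ω)⁻¹ 1 1 - 1 =
      -bogoliubovB c s ω t₀ t / bogoliubovA c s ω t₀ t := by
  have hs0 : (s t t₀ : ℂ) ≠ 0 := by exact_mod_cast hs
  have hω0 : (ω : ℂ) ≠ 0 := by exact_mod_cast hω.ne'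
  have hA := h.bogoliubovA_ne_zero hI hI' hω ht ht₀
  have e : bogoliubovA c s ω t₀ t - bogoliubovB c s ω t₀ t = complexSol c s ω t₀ t := by
    have h1 := h.mul_bogoliubovA hI hI' hω ht ht₀
    have h2 := h.mul_bogoliubovB hI hI' hω ht ht₀
    have h3 : (2 * ω : ℂ) ≠ 0 := mul_ne_zero two_ne_zero hω0
    refine mul_left_cancel₀ h3 ?_
    linear_combination h1 + h2
  rw [h.inv_Lam_apply hI hI' hω ht ht₀ hs, h.det_Lam_numerator hI hI' hω ht ht₀,
    sub_eq_iff_eq_add, div_add_one hA, neg_add_eq_sub, e, complexSol]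
  have := Complex.I_ne_zero
  push_cast
  field_simp
  linear_combination (-s t t₀ * ω : ℂ) * Complex.I_sq

/-! ### The amplitudes -/

theorem IsEvolution.inner_phi_apply_phi_zero {U : ℝ → ℝ → (L2 ≃ₗᵢ[ℂ] L2)}
    (hU : IsEvolution κ I U) (h : IsFundamentalPair κ I c s) (hI : IsOpen I)
    (hI' : I.OrdConnected) {ω t t₀ : ℝ} (hω : 0 < ω) (ht : t ∈ I) (ht₀ : t₀ ∈ I) (n : ℕ) :
    ⟪phi hω n, U t t₀ (phi hω 0)⟫_ℂ =
      phiConst ω 0 * phiConst ω n * Complex.exp (-logSol c s ω t₀ t / 2) *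
        gaussInt ((ω + gaussExponent c s ω t₀ t) / 2) (hermiteScaled ω n) := by
  have hZ : 0 < (gaussExponent c s ω t₀ t / 2).re := by
    simpa using h.re_gaussExponent_pos hI hI' hω ht ht₀
  rw [hU.apply_phi_zero h hI hI' hω ht ht₀, evolvedVacuum, toLp_smul_schwartz, inner_smul_right,
    inner_phi_gaussSchwartz hω n hZ, mul_one, add_div]
  ring

theorem IsFundamentalPair.re_half_add_gaussExponent_pos (h : IsFundamentalPair κ I c s)
    (hI : IsOpen I) (hI' : I.OrdConnected) {ω t t₀ : ℝ} (hω : 0 < ω) (ht : t ∈ I) (ht₀ : t₀ ∈ I) :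
    0 < (((ω : ℂ) + gaussExponent c s ω t₀ t) / 2).re := by
  simpa using h.re_add_gaussExponent_pos hI hI' hω ht ht₀

theorem IsEvolution.inner_phi_odd {U : ℝ → ℝ → (L2 ≃ₗᵢ[ℂ] L2)}
    (hU : IsEvolution κ I U) (h : IsFundamentalPair κ I c s) (hI : IsOpen I)
    (hI' : I.OrdConnected) {ω t t₀ : ℝ} (hω : 0 < ω) (ht : t ∈ I) (ht₀ : t₀ ∈ I) (n : ℕ) :
    ⟪phi hω (2 * n + 1), U t t₀ (phi hω 0)⟫_ℂ = 0 := by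
  rw [hU.inner_phi_apply_phi_zero h hI hI' hω ht ht₀,
    gaussInt_hermiteScaled_odd hω (h.re_half_add_gaussExponent_pos hI hI' hω ht ht₀), mul_zero]

theorem IsEvolution.inner_phi_even {U : ℝ → ℝ → (L2 ≃ₗᵢ[ℂ] L2)}
    (hU : IsEvolution κ I U) (h : IsFundamentalPair κ I c s) (hI : IsOpen I)
    (hI' : I.OrdConnected) {ω t t₀ : ℝ} (hω : 0 < ω) (ht : t ∈ I) (ht₀ : t₀ ∈ I) (n : ℕ) :
    ⟪phi hω (2 * n), U t t₀ (phi hω 0)⟫_ℂ =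
      ((Real.sqrt ((2 * n).factorial : ℝ) / (2 ^ n * (n.factorial : ℝ)) : ℝ) : ℂ) *
        (-bogoliubovB c s ω t₀ t / bogoliubovA c s ω t₀ t) ^ n *
        ⟪phi hω 0, U t t₀ (phi hω 0)⟫_ℂ := by
  have hC : phiConst ω (2 * n) * ((2 * n).factorial / n.factorial) =
      Real.sqrt ((2 * n).factorial : ℝ) / (2 ^ n * n.factorial) * phiConst ω 0 := by
    have h1 : (0 : ℝ) < Real.sqrt ((2 * n).factorial : ℝ) :=
      Real.sqrt_pos.2 (by exact_mod_cast Nat.factorial_pos _)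
    have h2 : Real.sqrt ((2 * n).factorial : ℝ) ^ 2 = (2 * n).factorial :=
      Real.sq_sqrt (Nat.cast_nonneg _)
    rw [phiConst_eq (2 * n), Real.sqrt_mul (by positivity), mul_comm 2 n, pow_mul,
      Real.sqrt_sq (by positivity), mul_comm n 2]
    nth_rewrite 2 [← h2]
    field_simp
  have hC' := congrArg Complex.ofReal hC
  rw [hU.inner_phi_apply_phi_zero h hI hI' hω ht ht₀,
    hU.inner_phi_apply_phi_zero h hI hI' hω ht ht₀ 0, hermiteScaled_zero,
    gaussInt_hermiteScaled_even hω (h.re_half_add_gaussExponent_pos hI hI' hω ht ht₀),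
    h.neg_B_div_A hI hI' hω ht ht₀]
  push_cast at hC' ⊢
  linear_combination phiConst ω 0 * Complex.exp (-logSol c s ω t₀ t / 2) *
    (ω / ((ω + gaussExponent c s ω t₀ t) / 2) - 1) ^ n *
    gaussInt ((ω + gaussExponent c s ω t₀ t) / 2) 1 * hC'

/-- This form also holds at the zeros of `s`: the principal logarithm is harmless since `Re(ω + Z) >
0`, and the winding of `u` is recorded by `g`. -/
theorem IsEvolution.vacuum_eq {U : ℝ → ℝ → (L2 ≃ₗᵢ[ℂ] L2)}
    (hU : IsEvolution κ I U) (h : IsFundamentalPair κ I c s) (hI : IsOpen I)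
    (hI' : I.OrdConnected) {ω t t₀ : ℝ} (hω : 0 < ω) (ht : t ∈ I) (ht₀ : t₀ ∈ I) :
    ⟪phi hω 0, U t t₀ (phi hω 0)⟫_ℂ = Real.sqrt (2 * ω) * Complex.exp (-logSol c s ω t₀ t / 2) *
      Complex.exp (-Complex.log (ω + gaussExponent c s ω t₀ t) / 2) := by
  have h1 : phiConst ω 0 * phiConst ω 0 * Real.sqrt (2 * Real.pi) = Real.sqrt (2 * ω) := by
    rw [← sq, phiConst_sq hω, pow_zero, Nat.factorial_zero, Nat.cast_one, mul_one, div_one,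
      ← Real.sqrt_mul (by positivity)]
    congr 1
    field_simp
  rw [hU.inner_phi_apply_phi_zero h hI hI' hω ht ht₀, hermiteScaled_zero,
    gaussInt_one (h.re_half_add_gaussExponent_pos hI hI' hω ht ht₀),
    two_pi_div_cpow_half (h.re_add_gaussExponent_pos hI hI' hω ht ht₀), ← h1]
  push_cast
  ring

theorem IsEvolution.vacuum_eq_vacuumAmplitude {U : ℝ → ℝ → (L2 ≃ₗᵢ[ℂ] L2)}
    (hU : IsEvolution κ I U) (h : IsFundamentalPair κ I c s) (hI : IsOpen I)
    (hI' : I.OrdConnected) {ω t t₀ : ℝ} (hω : 0 < ω) (ht : t ∈ I) (ht₀ : t₀ ∈ I)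
    (hs : s t t₀ ≠ 0) :
    ⟪phi hω 0, U t t₀ (phi hω 0)⟫_ℂ = vacuumAmplitude c s ω t t₀ := by
  have hs0 : (s t t₀ : ℂ) ≠ 0 := by exact_mod_cast hs
  have hω0 : (ω : ℂ) ≠ 0 := by exact_mod_cast hω.ne'
  have hA := h.bogoliubovA_ne_zero hI hI' hω ht ht₀
  have hA' := h.mul_bogoliubovA hI hI' hω ht ht₀
  have e : 2 * (ω : ℂ) / (Lam c s t₀ t ω ω).det = 2 * Complex.I * ω * s t t₀ /
      (Complex.exp (logSol c s ω t₀ t) * (ω + gaussExponent c s ω t₀ t)) := by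
    rw [h.exp_logSol hI hI' hω ht ht₀, mul_comm (complexSol c s ω t₀ t), ← hA',
      h.det_Lam_eq hI hI' hω ht ht₀ hs]
    have := Complex.I_ne_zero
    field_simp
    linear_combination -Complex.I_sq
  rw [hU.vacuum_eq h hI hI' hω ht ht₀, ← vacuum_branch hω
    (h.re_add_gaussExponent_pos hI hI' hω ht ht₀) (h.mul_s_eq hI hI' hω ht ht₀) hs,
    vacuumAmplitude, e, indexPow, h.zeroIndex_eq_floor hI hI' hω ht ht₀]

theorem IsEvolution.norm_vacuum_sq {U : ℝ → ℝ → (L2 ≃ₗᵢ[ℂ] L2)}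
    (hU : IsEvolution κ I U) (h : IsFundamentalPair κ I c s) (hI : IsOpen I)
    (hI' : I.OrdConnected) {ω t t₀ : ℝ} (hω : 0 < ω) (ht : t ∈ I) (ht₀ : t₀ ∈ I) :
    ‖⟪phi hω 0, U t t₀ (phi hω 0)⟫_ℂ‖ ^ 2 = ‖bogoliubovA c s ω t₀ t‖⁻¹ := by
  have hw := h.re_add_gaussExponent_pos hI hI' hω ht ht₀
  have hw0 : (ω : ℂ) + gaussExponent c s ω t₀ t ≠ 0 := fun h2 => by simp [h2] at hw
  have h1 := congrArg norm (h.mul_bogoliubovA hI hI' hω ht ht₀)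
  rw [norm_mul, norm_mul, norm_mul, Complex.norm_real, Real.norm_eq_abs, abs_of_pos hω,
    Complex.norm_ofNat] at h1
  have h2 := norm_pos_iff.2 hw0
  have h3 := norm_pos_iff.2 (h.complexSol_ne_zero hI hI' hω ht ht₀)
  have h4 := norm_pos_iff.2 (h.bogoliubovA_ne_zero hI hI' hω ht ht₀)
  rw [hU.vacuum_eq h hI hI' hω ht ht₀, norm_mul, norm_mul, mul_pow, mul_pow,
    h.norm_exp_neg_logSol_half_sq hI hI' hω ht ht₀, ← norm_pow (Complex.exp _),
    exp_log_half_sq hw0, Complex.norm_real, Real.norm_eq_abs, sq_abs,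
    Real.sq_sqrt (by positivity), norm_inv]
  field_simp
  linarith

theorem norm_phi_zero {ω : ℝ} (hω : 0 < ω) : ‖phi hω 0‖ = 1 := (orthonormal_phi hω).1 0

/-- With `x = |B/A|²` the squared amplitudes sum to `|A|⁻¹ (1 - x)^{-1/2} = 1`, the squared norm of
the evolved vacuum. -/
theorem IsEvolution.hasSum_phi {U : ℝ → ℝ → (L2 ≃ₗᵢ[ℂ] L2)}
    (hU : IsEvolution κ I U) (h : IsFundamentalPair κ I c s) (hI : IsOpen I)
    (hI' : I.OrdConnected) {ω t t₀ : ℝ} (hω : 0 < ω) (ht : t ∈ I) (ht₀ : t₀ ∈ I) :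
    HasSum (fun n : ℕ => ⟪phi hω (2 * n), U t t₀ (phi hω 0)⟫_ℂ • phi hω (2 * n))
      (U t t₀ (phi hω 0)) := by
  have hA := norm_pos_iff.2 (h.bogoliubovA_ne_zero hI hI' hω ht ht₀)
  have hAB := h.norm_bogoliubov_sq hI hI' hω ht ht₀
  set A := bogoliubovA c s ω t₀ t
  set B := bogoliubovB c s ω t₀ t
  refine hasSum_of_hasSum_norm_sq (e := fun n : ℕ => phi hω (2 * n))
    ((orthonormal_phi hω).comp _ (mul_right_injective₀ two_ne_zero)) ?_
  have hx : 1 - ‖B‖ ^ 2 / ‖A‖ ^ 2 = (‖A‖⁻¹) ^ 2 := by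
    field_simp
    linarith
  have hx0 : 0 ≤ ‖B‖ ^ 2 / ‖A‖ ^ 2 := by positivity
  have hx1 : |‖B‖ ^ 2 / ‖A‖ ^ 2| < 1 := by
    rw [abs_of_nonneg hx0]
    have : 0 < (‖A‖⁻¹) ^ 2 := by positivity
    linarith
  have hsum := (hasSum_centralBinom hx1).mul_right ‖A‖⁻¹
  rw [hx, Real.sqrt_sq (by positivity), inv_inv, mul_inv_cancel₀ hA.ne'] at hsum
  rw [LinearIsometryEquiv.norm_map, norm_phi_zero, one_pow]
  refine hsum.congr_fun fun n => ?_
  rw [hU.inner_phi_even h hI hI' hω ht ht₀, norm_mul, mul_pow,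
    hU.norm_vacuum_sq h hI hI' hω ht ht₀, norm_mul, mul_pow, Complex.norm_real, Real.norm_eq_abs,
    sq_abs, div_pow, Real.sq_sqrt (Nat.cast_nonneg _), norm_pow, norm_div, norm_neg, mul_pow,
    ← div_pow, ← pow_mul, ← pow_mul, ← pow_mul, mul_comm n 2, pow_mul (2 : ℝ)]
  norm_num
  rfl

/-- At a zero of `s` the Wronskian forces `ṡ ≠ 0`, so the zero is isolated. -/
theorem IsFundamentalPair.eventually_s_ne_zero (h : IsFundamentalPair κ I c s) (hI : IsOpen I)
    (hI' : I.OrdConnected) {t t₀ : ℝ} (ht : t ∈ I) (ht₀ : t₀ ∈ I) (hs : s t t₀ = 0) :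
    ∀ᶠ τ in 𝓝[≠] t, s τ t₀ ≠ 0 := by
  have hW := h.wronskian_eq_one hI hI' ht ht₀
  have hd : dot s t t₀ ≠ 0 := by
    intro h0
    simp [hs, h0] at hW
  exact (h.s_solution t₀ ht₀ t ht).1.hasDerivAt.eventually_ne hd

/-- `φ₀` is a Schwartz function, so the weak Schrödinger equation itself makes this matrix element
differentiable in time. -/
theorem IsEvolution.continuousAt_vacuum {U : ℝ → ℝ → (L2 ≃ₗᵢ[ℂ] L2)}
    (hU : IsEvolution κ I U) {ω t t₀ : ℝ} (hω : 0 < ω) (ht : t ∈ I) (ht₀ : t₀ ∈ I) :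
    ContinuousAt (fun τ => ⟪phi hω 0, U τ t₀ (phi hω 0)⟫_ℂ) t := by
  rw [phi_eq_toLp, ← toLp_smul_schwartz]
  exact (hU.schrodinger t₀ ht₀ t ht _ _).continuousAt

theorem IsEvolution.tendsto_vacuumAmplitude {U : ℝ → ℝ → (L2 ≃ₗᵢ[ℂ] L2)}
    (hU : IsEvolution κ I U) (h : IsFundamentalPair κ I c s) (hI : IsOpen I)
    (hI' : I.OrdConnected) {ω t t₀ : ℝ} (hω : 0 < ω) (ht : t ∈ I) (ht₀ : t₀ ∈ I)
    (hs : s t t₀ = 0) :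
    Tendsto (fun τ => vacuumAmplitude c s ω τ t₀) (𝓝[≠] t)
      (𝓝 ⟪phi hω 0, U t t₀ (phi hω 0)⟫_ℂ) := by
  refine ((hU.continuousAt_vacuum hω ht ht₀).tendsto.mono_left nhdsWithin_le_nhds).congr' ?_
  filter_upwards [h.eventually_s_ne_zero hI hI' ht ht₀ hs,
    nhdsWithin_le_nhds (hI.mem_nhds ht)] with τ h1 h2
  exact hU.vacuum_eq_vacuumAmplitude h hI hI' hω h2 ht₀ h1

end Amplitudes

end TDHO

theorem theoremD6 (κ : ℝ → ℝ) (I : Set ℝ) (hI : IsOpen I) (hI' : I.OrdConnected)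
    (hκ : ContinuousOn κ I) (c s : ℝ → ℝ → ℝ) (hcs : TDHO.IsFundamentalPair κ I c s)
    (U : ℝ → ℝ → (TDHO.L2 ≃ₗᵢ[ℂ] TDHO.L2)) (hU : TDHO.IsEvolution κ I U)
    (ω : ℝ) (hω : 0 < ω) (t₀ : ℝ) (ht₀ : t₀ ∈ I) (t : ℝ) (ht : t ∈ I) :
    -- the evolved vacuum is a superposition of the even states only
    HasSum (fun n : ℕ => ⟪TDHO.phi hω (2 * n), U t t₀ (TDHO.phi hω 0)⟫_ℂ • TDHO.phi hω (2 * n))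
      (U t t₀ (TDHO.phi hω 0)) ∧
    (∀ n : ℕ, ⟪TDHO.phi hω (2 * n + 1), U t t₀ (TDHO.phi hω 0)⟫_ℂ = 0) ∧
    -- the amplitudes in terms of the Bogoliubov coefficients
    TDHO.bogoliubovA c s ω t₀ t ≠ 0 ∧
    (∀ n : ℕ, ⟪TDHO.phi hω (2 * n), U t t₀ (TDHO.phi hω 0)⟫_ℂ =
      ((Real.sqrt ((2 * n).factorial : ℝ) / (2 ^ n * (n.factorial : ℝ)) : ℝ) : ℂ) *
        (-TDHO.bogoliubovB c s ω t₀ t / TDHO.bogoliubovA c s ω t₀ t) ^ n *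
        ⟪TDHO.phi hω 0, U t t₀ (TDHO.phi hω 0)⟫_ℂ) ∧
    -- away from the zeros of `s(·, t₀)`: the explicit formulas in terms of `Λ`
    (s t t₀ ≠ 0 →
      (TDHO.Lam c s t₀ t ω ω).det ≠ 0 ∧
      (∀ n : ℕ, ⟪TDHO.phi hω (2 * n), U t t₀ (TDHO.phi hω 0)⟫_ℂ =
        ((Real.sqrt ((2 * n).factorial : ℝ) / (2 ^ n * (n.factorial : ℝ)) : ℝ) : ℂ) *
          (2 * (ω : ℂ) * (TDHO.Lam c s t₀ t ω ω)⁻¹ 1 1 - 1) ^ n *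
          ⟪TDHO.phi hω 0, U t t₀ (TDHO.phi hω 0)⟫_ℂ) ∧
      ⟪TDHO.phi hω 0, U t t₀ (TDHO.phi hω 0)⟫_ℂ = TDHO.vacuumAmplitude c s ω t t₀ ∧
      (1 + ω ^ 2 * s t t₀ ^ 2 - c t t₀ * c t₀ t : ℂ)
        - Complex.I * ω * s t t₀ * (c t t₀ + c t₀ t) ≠ 0 ∧
      (TDHO.Lam c s t₀ t ω ω)⁻¹ 1 1 =
        (ω * s t t₀ ^ 2 - Complex.I * s t t₀ * c t t₀ : ℂ) /
          ((1 + ω ^ 2 * s t t₀ ^ 2 - c t t₀ * c t₀ t : ℂ)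
            - Complex.I * ω * s t t₀ * (c t t₀ + c t₀ t))) ∧
    -- at the zeros of `s(·, t₀)` the vacuum amplitude is the limit of the explicit formula
    (s t t₀ = 0 →
      Tendsto (fun τ => TDHO.vacuumAmplitude c s ω τ t₀) (𝓝[≠] t)
        (𝓝 ⟪TDHO.phi hω 0, U t t₀ (TDHO.phi hω 0)⟫_ℂ)) := by
  refine ⟨hU.hasSum_phi hcs hI hI' hω ht ht₀, hU.inner_phi_odd hcs hI hI' hω ht ht₀,
    hcs.bogoliubovA_ne_zero hI hI' hω ht ht₀, hU.inner_phi_even hcs hI hI' hω ht ht₀,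
    fun hs => ⟨hcs.det_Lam_ne_zero hI hI' hω ht ht₀ hs, fun n => ?_,
      hU.vacuum_eq_vacuumAmplitude hcs hI hI' hω ht ht₀ hs,
      hcs.det_Lam_numerator_ne_zero hI hI' hω ht ht₀ hs,
      hcs.inv_Lam_apply hI hI' hω ht ht₀ hs⟩,
    hU.tendsto_vacuumAmplitude hcs hI hI' hω ht ht₀⟩
  rw [hcs.two_mul_inv_Lam_sub_one hI hI' hω ht ht₀ hs]
  exact hU.inner_phi_even hcs hI hI' hω ht ht₀ n
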